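/- Let $n\ge 3$ and let $t_1<\dots<t_n$ be real; together with $t_\infty=\infty$ they are the vertices of a conformal polygon on the upper half-plane $\mathbb H$. An orthodisk $X$ with vertex data $a_i$ on this polygon is given by odd integers $a_1,\dots,a_n$ such that $a_\infty=-4-\sum_i a_i$ is odd as well (so $n$ is odd), and by a developing map $F$ on $\overline{\mathbb H}$ minus the vertices with $F'(z)=\lambda\prod_i (z-t_i)^{a_i/2}$, $\lambda\in\mathbb C\setminus\{0\}$; a vertex is finite if $a_i>-2$ and infinite otherwise. $F$ maps the $n+1$ edges between consecutive vertices, oriented by increasing $t$, into straight lines, every other one of which is parallel; the periods of $X$ are the oriented distances (orthogonal displacement vectors in $\mathbb C$) between parallel edges. Let $Z$ be the compact hyperelliptic Riemann surface $y^2=\prod_i(z-t_i)$, branched over $t_1,\dots,t_n,\infty$. The differential $dF$ extends to the meromorphic form $\omega_X=\lambda\,y\prod_i(z-t_i)^{(a_i-1)/2}dz$ on $Z$. Let $X_1,X_2$ be reflexive orthodisks with vertex data $a_i\neq b_i$ (as families): they are given on the same conformal polygon, and they are conjugate, that is, there is a line $l\subset\mathbb C$ through $0$ such that the reflection in $l$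 carries the directions of the oriented developed edges of $X_1$ to those of the corresponding edges of $X_2$, and the periods of $X_1$ to the corresponding periods of $X_2$. Suppose that $a_i+b_i\equiv 0 \pmod 4$ for $i=1,\dots,n$. Then, after multiplying $\omega_{X_1}$ and $\omega_{X_2}$ by a common constant of modulus $1$ to obtain $\omega_1,\omega_2$, there are a real number $r\ne0$ and a meromorphic function $G$ on $Z$ such that, with $dh=r\prod_i (z-t_i)^{(a_i+b_i)/4}\,dz$ (lifted to $Z$), $$\omega_1=G\,dh,\qquad \omega_2=G^{-1}\,dh,$$ and $G$, $dh$ are the Weierstrass data of a minimal surface: for every closed curve $\gamma$ in $Z$ avoiding the vertices, $$\operatorname{Re}\int_\gamma dh=0,\qquad \int_\gamma G\,dh=\overline{\int_\gamma G^{-1}dh},$$ and $$p\mapsto \operatorname{Re}\int^p\Bigl(\tfrac12(G-G^{-1})\,dh,\ \tfrac i2(G+G^{-1})\,dh,\ dh\Bigr)$$ is a well-defined conformal harmonic map to $\mathbb R^3$ on $Z$ minus the points over vertices that are infinite for $X_1$ or for $X_2$; it is an immersion except at the points over vertices whose vertex data are positive in both $X_1$ and $X_2$ (where the metric $(|G|+|G|^{-1})|dh|$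 vanishes). -/

import Mathlib

open scoped ComplexConjugate Topology

noncomputable section

/-- A conformal polygon: the upper half-plane with `n ≥ 3` distinguished real points
`t 0 < t 1 < ... < t (n-1)`; the point at infinity is a further distinguished point. -/
structure ConformalPolygon (n : ℕ) where
  t : Fin n → ℝ
  strictMono : StrictMono t
  three_le : 3 ≤ n

/-- An orthodisk on the conformal polygon `P`: odd vertex data `a i`, with the vertex datum at
infinity `-4 - ∑ a i` also odd, and a nonzero complex factor, so that the flat metric is the
pull-back of the metric of `ℂ` under a constant multiple of the Schwarz-Christoffel map. -/
structure Orthodisk {n : ℕ} (P : ConformalPolygon n) where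
  a : Fin n → ℤ
  odd_a : ∀ i, Odd (a i)
  odd_infty : Odd (-4 - ∑ i, a i)
  scale : ℂ
  scale_ne : scale ≠ 0

namespace ConformalPolygon

variable {n : ℕ} (P : ConformalPolygon n)

/-- The open edges of the polygon: `edge 0 = (-∞, t 0)`, `edge j = (t (j-1), t j)` for
`0 < j < n`, and `edge n = (t (n-1), ∞)`. -/
def edge (j : Fin (n + 1)) : Set ℝ :=
  {x | ∀ i : Fin n, ((i : ℕ) < j → P.t i < x) ∧ ((j : ℕ) ≤ i → x < P.t i)}

/-- The affine hyperelliptic curve `y ^ 2 = ∏ (z - t i)`; its points are pairs `(z, y)`. -/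
abbrev AffineCurve : Type :=
  {p : ℂ × ℂ // p.2 ^ 2 = ∏ i, (p.1 - (P.t i : ℂ))}

/-- The compact hyperelliptic surface `Z`, the double cover of the sphere branched over the
points `t i` and `∞`. As `n` is odd, there is exactly one point over `∞`. -/
abbrev Z : Type := OnePoint P.AffineCurve

/-- The covering projection `z` (with value `0` at the point at infinity). -/
def zc (p : P.Z) : ℂ := OnePoint.elim p 0 (fun q => q.1.1)

/-- The function `y` (with value `0` at the point at infinity). -/
def yc (p : P.Z) : ℂ := OnePoint.elim p 0 (fun q => q.1.2)

/-- The points of `Z` that do not lie over a vertex. -/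
def ordinary : Set P.Z := {p | p ≠ OnePoint.infty ∧ P.yc p ≠ 0}

/-- A holomorphic local coordinate of `Z`, given as an injective holomorphic map `σ` from an
open set `U` of `ℂ` into `Z`: it is continuous into `Z`, and the coordinate functions
`z`, `y` are holomorphic where `σ` does not take the value `∞`. -/
def IsLocalChart (U : Set ℂ) (σ : ℂ → P.Z) : Prop :=
  IsOpen U ∧ ContinuousOn σ U ∧ Set.InjOn σ U ∧
    DifferentiableOn ℂ (fun s => P.zc (σ s)) {s ∈ U | σ s ≠ OnePoint.infty} ∧
    DifferentiableOn ℂ (fun s => P.yc (σ s)) {s ∈ U | σ s ≠ OnePoint.infty}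

/-- Meromorphic functions on `Z`. -/
def IsMeromorphic (f : P.Z → ℂ) : Prop :=
  ∀ (U : Set ℂ) (σ : ℂ → P.Z), P.IsLocalChart U σ → MeromorphicOn (fun s => f (σ s)) U

/-! A meromorphic `1`-form `R dz` on `Z` is given by its coefficient `R : Z → ℂ`. Only the
values of `R` at ordinary points matter. -/

/-- Closed continuously differentiable curves in the set of ordinary points of `Z`. -/
def IsClosedCurve (γ : ℝ → P.Z) : Prop :=
  (∀ τ ∈ Set.Icc (0 : ℝ) 1, γ τ ∈ P.ordinary) ∧ γ 0 = γ 1 ∧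
    ContDiffOn ℝ 1 (fun τ => P.zc (γ τ)) (Set.Icc 0 1) ∧
    ContDiffOn ℝ 1 (fun τ => P.yc (γ τ)) (Set.Icc 0 1)

/-- The integral of the `1`-form `R dz` along the curve `γ`. -/
def formIntegral (R : P.Z → ℂ) (γ : ℝ → P.Z) : ℂ :=
  ∫ τ in (0 : ℝ)..1, R (γ τ) * deriv (fun τ' => P.zc (γ τ')) τ

/-- The coefficient (with respect to `ds`) of the pull-back of `R dz` in a local coordinate
`σ`, at a point `s` with `σ s` ordinary. -/
def pullback (R : P.Z → ℂ) (σ : ℂ → P.Z) (s : ℂ) : ℂ :=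
  R (σ s) * deriv (fun w => P.zc (σ w)) s

end ConformalPolygon

namespace Orthodisk

variable {n : ℕ} {P : ConformalPolygon n}

/-- The vertex datum at infinity. -/
def aInfty (X : Orthodisk P) : ℤ := -4 - ∑ i, X.a i

/-- The derivative `scale * ∏ (z - t i) ^ (a i / 2)` of the developing map. The principal
branch is holomorphic on the upper half-plane, and its values at the real points are the
boundary values from above. -/
def integrand (X : Orthodisk P) (z : ℂ) : ℂ :=
  X.scale * ∏ i, (z - (P.t i : ℂ)) ^ ((X.a i : ℂ) / 2)

/-- The developing map (Schwarz-Christoffel map), the integral of `integrand` from the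
imaginary unit to `z`, for `z` in the closed upper half-plane without the vertices. -/
def develop (X : Orthodisk P) (z : ℂ) : ℂ :=
  ∫ s in (0 : ℝ)..1, X.integrand (Complex.I + s * (z - Complex.I)) * (z - Complex.I)

/-- The unit vector that is the direction, at the real point `p`, of the developed boundary,
which is oriented by increasing `p`. It is constant along each edge. -/
def direction (X : Orthodisk P) (p : ℝ) : ℂ :=
  X.integrand p / (‖X.integrand p‖ : ℂ)

/-- The oriented distance from the developed edge through `p` to the developed edge through
`q`: the component of `develop q - develop p` that is orthogonal to the edge through `p`.
If the two edges are parallel, it depends only on the edges, not on `p` and `q`. -/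
def period (X : Orthodisk P) (p q : ℝ) : ℂ :=
  (X.develop q - X.develop p) -
    (((conj (X.direction p) * (X.develop q - X.develop p)).re : ℝ) : ℂ) * X.direction p

/-- The canonical `1`-form of the orthodisk on the double cover `Z`, namely
`scale * y * ∏ (z - t i) ^ ((a i - 1) / 2) dz`, given by its coefficient. -/
def canonicalForm (X : Orthodisk P) (p : P.Z) : ℂ :=
  X.scale * P.yc p * ∏ i, (P.zc p - (P.t i : ℂ)) ^ ((X.a i - 1) / 2)

/-- On the upper half-plane, in the sheet of `Z` on which `y = ∏ (z - t i) ^ (1 / 2)`, the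
canonical form is the differential of the developing map. -/
theorem canonicalForm_eq_integrand (X : Orthodisk P) (p : P.Z) (him : 0 < (P.zc p).im)
    (hy : P.yc p = ∏ i, (P.zc p - (P.t i : ℂ)) ^ ((1 : ℂ) / 2)) :
    X.canonicalForm p = X.integrand (P.zc p) := by
  unfold canonicalForm integrand
  rw [hy, mul_assoc, ← Finset.prod_mul_distrib]
  congr 1
  refine Finset.prod_congr rfl fun i _ => ?_
  have hne : P.zc p - (P.t i : ℂ) ≠ 0 := by
    intro h
    have h2 := congrArg Complex.im h
    simp at h2
    exact him.ne' h2
  obtain ⟨k, hk⟩ := X.odd_a i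
  have h1 : (X.a i - 1) / 2 = k := by omega
  rw [h1, ← Complex.cpow_intCast, ← Complex.cpow_add _ _ hne, hk]
  congr 1
  push_cast
  ring

/-- Reflection of `ℂ` in the real line through `0` that is spanned by the unit vector `e`. -/
def reflect (e w : ℂ) : ℂ := e ^ 2 * conj w

/-- The developed images of `X₁` and `X₂` are conjugate with respect to the line spanned by the
unit vector `e`: the reflection in this line carries the directions of the edges of `X₁` to
the directions of the corresponding edges of `X₂`, and the oriented distances between parallel
edges (that is, edges whose indices have the same parity) of `X₁` to the corresponding ones
of `X₂`. -/
def ConjugateAlong (e : ℂ) (X₁ X₂ : Orthodisk P) : Prop :=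
  (∀ j : Fin (n + 1), ∀ p ∈ P.edge j, X₂.direction p = reflect e (X₁.direction p)) ∧
  (∀ j k : Fin (n + 1), (j : ℕ) % 2 = (k : ℕ) % 2 → ∀ p ∈ P.edge j, ∀ q ∈ P.edge k,
    X₂.period p q = reflect e (X₁.period p q))

/-- Reflexive orthodisks: they have the same underlying conformal polygon and different vertex
data, and they are conjugate with respect to some line. -/
def Reflexive (X₁ X₂ : Orthodisk P) : Prop :=
  X₁.a ≠ X₂.a ∧ ∃ e : ℂ, ‖e‖ = 1 ∧ ConjugateAlong e X₁ X₂

/-- The lift to `Z` of the form `∏ (z - t i) ^ ((a i + b i) / 4) dz` on the sphere, given by its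
coefficient. -/
def heightForm (X₁ X₂ : Orthodisk P) (p : P.Z) : ℂ :=
  ∏ i, (P.zc p - (P.t i : ℂ)) ^ ((X₁.a i + X₂.a i) / 4)

/-- The part of `Z` on which the surface is defined: the complement of the points over vertices
that are infinite for at least one of the two orthodisks. -/
def surfaceDomain (X₁ X₂ : Orthodisk P) : Set P.Z :=
  {p | (p = OnePoint.infty → -2 < X₁.aInfty ∧ -2 < X₂.aInfty) ∧
    (p ≠ OnePoint.infty → ∀ i, P.zc p = (P.t i : ℂ) → -2 < X₁.a i ∧ -2 < X₂.a i)}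

/-- The points at which the metric `(|G| + 1 / |G|) |dh|` of the surface vanishes: here both
canonical forms have a zero, so that the surface has a branch point. -/
def branchPoints (X₁ X₂ : Orthodisk P) : Set P.Z :=
  {p | (p = OnePoint.infty ∧ 0 < X₁.aInfty ∧ 0 < X₂.aInfty) ∨
    (p ≠ OnePoint.infty ∧ ∃ i, P.zc p = (P.t i : ℂ) ∧ 0 < X₁.a i ∧ 0 < X₂.a i)}

end Orthodisk

/-- The three `1`-forms of the Weierstrass representation with Gauss map `G` and height
differential `h dz`, given by their coefficients. -/
def weierstrassForm {n : ℕ} (P : ConformalPolygon n) (G h : P.Z → ℂ) : Fin 3 → P.Z → ℂ :=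
  ![fun p => (1 / 2) * (G p - (G p)⁻¹) * h p,
    fun p => (Complex.I / 2) * (G p + (G p)⁻¹) * h p,
    fun p => h p]

/-- The map `Φ` is a well-defined minimal surface on the domain `D ⊆ Z`, with Weierstrass data
`G`, `h dz` and with branch points in `B` only. In every local coordinate `σ` of `Z`:
at ordinary points, the differential of `Φ` is the real part of the Weierstrass forms;
on all of `D`, the map `Φ` is harmonic and conformal, and it is an immersion outside `B`. -/
def IsWeierstrassSurface {n : ℕ} (P : ConformalPolygon n) (G h : P.Z → ℂ) (D B : Set P.Z)
    (Φ : P.Z → EuclideanSpace ℝ (Fin 3)) : Prop :=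
  ∀ (U : Set ℂ) (σ : ℂ → P.Z), P.IsLocalChart U σ → ∀ s ∈ U,
    (σ s ∈ P.ordinary → ∀ (v : ℂ) (k : Fin 3),
      (fderiv ℝ (fun w => Φ (σ w)) s v) k
        = (P.pullback (weierstrassForm P G h k) σ s * v).re) ∧
    (σ s ∈ D →
      InnerProductSpace.HarmonicAt (fun w => Φ (σ w)) s ∧
      ‖fderiv ℝ (fun w => Φ (σ w)) s 1‖ = ‖fderiv ℝ (fun w => Φ (σ w)) s Complex.I‖ ∧
      inner ℝ (fderiv ℝ (fun w => Φ (σ w)) s 1) (fderiv ℝ (fun w => Φ (σ w)) s Complex.I) = 0 ∧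
      (σ s ∉ B → Function.Injective (fderiv ℝ (fun w => Φ (σ w)) s)))

end

/-! Let `c = conj e`. On the closed upper half-plane without the vertices, consider the difference
of the rotated developing maps, `c F₁ - conj (c F₂)`, whose differential is `c ω₁ - conj (c ω₂)`.
Conjugate directions and periods say that, between two points on parallel edges, this difference
moves in the common direction of `c F₁` and `conj (c F₂)` along these edges (`reflection_algebra`).
After division by the unit direction of the last edge and subtraction of one constant, it is
therefore real on every other edge and imaginary on the remaining ones
(`exists_normalized_developDiff`). This is exactly the boundary behaviour that lets it be continued
by reflection to a single-valued function on the double cover (`exists_double_cover_extension`). So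
`c ω₁ - conj (c ω₂)` is exact off the vertices, and the periods of `c ω₁` and `c ω₂` are conjugate.

Since `y ^ 2 = ∏ (z - t i)`, the product of the canonical forms is a constant times the square of `∏
(z - t i) ^ ((a i + b i) / 4) dz` (`canonicalForm_mul`). The factor `c ^ 2` makes the constant
positive, because the rotated scale factors have conjugate directions; `r` is its square root and `G
= c ω₁ / dh`. The height form has an expansion in powers of `z - t i` with real coefficients, so its
residues are real and the real part of its integral is single-valued (`exists_height_potential`).

The coordinates of the surface are real linear in these two potentials. It remains to pass to the
points over the vertices. In a local chart the order of each canonical form is its vertex datum plus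
one, both over `t i` and over infinity, so all forms are holomorphic on the surface domain
(`orders_of_mem_surfaceDomain`). The potentials then extend as a holomorphic minus an
antiholomorphic function, and harmonicity, conformality and immersion are read off from `α₁ α₂ = β ^
2` (`coordinateMap_conformal`). -/

/-! ### Complex analysis in one variable. -/

open Filter in
/-- A holomorphic function that is injective near a point has nonvanishing derivative there. -/
theorem AnalyticAt.deriv_ne_zero_of_injOn {f : ℂ → ℂ} {s₀ : ℂ} (hf : AnalyticAt ℂ f s₀)
    {V : Set ℂ} (hV : V ∈ 𝓝 s₀) (hinj : Set.InjOn f V) : deriv f s₀ ≠ 0 := by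
  intro hd
  set F : ℂ → ℂ := fun s => f s - f s₀ with hF
  have hFa : AnalyticAt ℂ F s₀ := hf.sub analyticAt_const
  have hord : analyticOrderAt F s₀ ≠ ⊤ := by
    intro h
    rw [analyticOrderAt_eq_top] at h
    have h2 : ∀ᶠ s in 𝓝[≠] s₀, False := by
      filter_upwards [h.filter_mono nhdsWithin_le_nhds, mem_nhdsWithin_of_mem_nhds hV,
        self_mem_nhdsWithin] with s h1 h2 h3
      exact h3 (hinj h2 (mem_of_mem_nhds hV) (sub_eq_zero.mp h1))
    exact h2.exists.elim fun _ h => h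
  obtain ⟨k, hk⟩ := ENat.ne_top_iff_exists.mp hord
  obtain ⟨g, hg, hg0, hgF⟩ := (hFa.analyticOrderAt_eq_natCast).mp hk.symm
  have hk2 : 2 ≤ k := by
    by_contra hlt
    have : k = 0 ∨ k = 1 := by omega
    rcases this with rfl | rfl
    · have := hgF.self_of_nhds
      simp [hF] at this
      exact hg0 this.symm
    · have h1 : HasDerivAt (fun z => (z - s₀) ^ 1 • g z) (g s₀) s₀ := by
        have := ((hasDerivAt_id s₀).sub_const s₀).mul hg.differentiableAt.hasDerivAt
        simpa using! this
      have h2 : deriv F s₀ = g s₀ := (h1.congr_of_eventuallyEq hgF).deriv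
      have h3 : deriv F s₀ = deriv f s₀ := by simp [hF, deriv_sub_const]
      exact hg0 (by rw [← h2, h3, hd])
  have hk0 : (k : ℂ) ≠ 0 := by exact_mod_cast (by omega : k ≠ 0)
  -- The quotient is `1` at `s₀`, so its principal `k`-th root is analytic there. Then `m` is a
  -- local coordinate in which `f - f s₀` is `g s₀` times a `k`-th power.
  set q : ℂ → ℂ := fun s => (g s / g s₀) ^ ((k : ℂ)⁻¹) with hq
  have hqa : AnalyticAt ℂ q s₀ := by
    apply AnalyticAt.cpow (hg.div_const) analyticAt_const
    rw [div_self hg0]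
    exact Complex.one_mem_slitPlane
  set m : ℂ → ℂ := fun s => (s - s₀) * q s with hm
  have hma : AnalyticAt ℂ m s₀ := (analyticAt_id.sub analyticAt_const).mul hqa
  have hm0 : m s₀ = 0 := by simp [hm]
  have hq0 : q s₀ = 1 := by simp [hq, div_self hg0]
  have hmd : deriv m s₀ = 1 := by
    have := ((hasDerivAt_id s₀).sub_const s₀).mul hqa.differentiableAt.hasDerivAt
    have h2 : HasDerivAt m 1 s₀ := by simpa [hq0] using! this
    exact h2.deriv
  have hFm : ∀ᶠ s in 𝓝 s₀, f s = f s₀ + g s₀ * m s ^ k := by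
    filter_upwards [hgF] with s hs
    have : F s = g s₀ * m s ^ k := by
      rw [hs, hm, hq]
      simp only [mul_pow, smul_eq_mul]
      rw [Complex.cpow_nat_inv_pow _ (by omega)]
      field_simp
    rw [← this]; simp [hF]
  have hopen : 𝓝 (m s₀) ≤ map m (𝓝 s₀) := by
    refine hma.eventually_constant_or_nhds_le_map_nhds.resolve_left fun h => ?_
    have : deriv m s₀ = 0 := by
      rw [EventuallyEq.deriv_eq (show m =ᶠ[𝓝 s₀] fun _ => m s₀ from h), deriv_const]
    rw [hmd] at this
    exact one_ne_zero this
  rw [hm0] at hopen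
  have hW : {s | f s = f s₀ + g s₀ * m s ^ k} ∩ V ∈ 𝓝 s₀ := inter_mem hFm hV
  have himg : m '' ({s | f s = f s₀ + g s₀ * m s ^ k} ∩ V) ∈ 𝓝 (0 : ℂ) :=
    hopen (image_mem_map hW)
  -- Multiplication of `m` by a `k`-th root of unity does not change `f`. As `2 ≤ k`, the points
  -- with `m = w` and `m = ξ * w` are distinct, against injectivity.
  obtain ⟨ξ, hξ⟩ : ∃ ξ : ℂ, IsPrimitiveRoot ξ k :=
    ⟨_, Complex.isPrimitiveRoot_exp k (by omega)⟩
  have hcont : Tendsto (fun w : ℂ => ξ * w) (𝓝 0) (𝓝 0) := by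
    have : Continuous fun w : ℂ => ξ * w := by fun_prop
    simpa using this.tendsto 0
  have hev : ∀ᶠ w in 𝓝[≠] (0 : ℂ), w ≠ 0 ∧
      w ∈ m '' ({s | f s = f s₀ + g s₀ * m s ^ k} ∩ V) ∧
      ξ * w ∈ m '' ({s | f s = f s₀ + g s₀ * m s ^ k} ∩ V) := by
    filter_upwards [self_mem_nhdsWithin, mem_nhdsWithin_of_mem_nhds himg,
      mem_nhdsWithin_of_mem_nhds (hcont himg)] with w h1 h2 h3
    exact ⟨h1, h2, h3⟩
  obtain ⟨w, hw0, ⟨s, hs, hsw⟩, ⟨s', hs', hsw'⟩⟩ := hev.exists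
  have heq : f s = f s' := by
    rw [hs.1, hs'.1, hsw, hsw', mul_pow, hξ.pow_eq_one, one_mul]
  have := hinj hs.2 hs'.2 heq
  rw [this, hsw'] at hsw
  have h1 : ξ = 1 := mul_right_cancel₀ hw0 (by simpa using hsw)
  exact hξ.ne_one (by omega) h1

/-- The punctured disc is the image of the half-plane `re w < log r` under the continuous map `s₀ +
exp w`. -/
theorem Complex.isPreconnected_ball_diff_singleton (s₀ : ℂ) (r : ℝ) :
    IsPreconnected (Metric.ball s₀ r \ {s₀}) := by
  rcases le_or_gt r 0 with hr | hr
  · rw [Metric.ball_eq_empty.mpr hr]; simpa using isPreconnected_empty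
  have h : Metric.ball s₀ r \ {s₀} =
      (fun w => s₀ + Complex.exp w) '' {w : ℂ | w.re < Real.log r} := by
    ext z
    constructor
    · rintro ⟨h1, h2⟩
      have hz : z - s₀ ≠ 0 := sub_ne_zero.mpr h2
      refine ⟨Complex.log (z - s₀), ?_, by simp [Complex.exp_log hz]⟩
      simp only [Set.mem_ofPred_eq, Complex.log_re]
      apply Real.log_lt_log (norm_pos_iff.mpr hz)
      simpa [dist_eq_norm] using h1
    · rintro ⟨w, hw, rfl⟩
      refine ⟨?_, by simp⟩
      simp only [Metric.mem_ball, dist_eq_norm, add_sub_cancel_left, Complex.norm_exp]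
      rw [← Real.exp_log hr]
      exact Real.exp_lt_exp.mpr hw
  rw [h]
  apply ((convex_halfSpace_re_lt (Real.log r)).isPreconnected).image
  fun_prop

/-- The real linear map `v ↦ a v - conj (b v)`. -/
noncomputable def pairForm (a b : ℂ) : ℂ →L[ℝ] ℂ :=
  (ContinuousLinearMap.mul ℝ ℂ a) -
    (Complex.conjCLE : ℂ →L[ℝ] ℂ).comp (ContinuousLinearMap.mul ℝ ℂ b)

@[simp] theorem pairForm_apply (a b v : ℂ) : pairForm a b v = a * v - conj (b * v) := by
  simp [pairForm]

/-- Every potential in the proof is locally a function `A - conj B` with holomorphic `A` and `B`,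
and `pairForm` records its differential. A pair `(f, -f)` belongs to twice the real part of an
integral of `f`. -/
theorem HasDerivAt.hasFDerivAt_pairForm {A B : ℂ → ℂ} {a b s : ℂ} (hA : HasDerivAt A a s)
    (hB : HasDerivAt B b s) : HasFDerivAt (fun s => A s - conj (B s)) (pairForm a b) s := by
  have h1 := hA.hasFDerivAt.restrictScalars ℝ
  have h2 := (Complex.conjCLE : ℂ →L[ℝ] ℂ).hasFDerivAt.comp s (hB.hasFDerivAt.restrictScalars ℝ)
  refine (h1.sub h2).congr_fderiv ?_
  ext v; simp [mul_comm]

/-- Holomorphic functions on a convex open set have primitives. -/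
theorem Convex.exists_primitive {K : Set ℂ} (hK : Convex ℝ K) (hKo : IsOpen K) {f : ℂ → ℂ}
    (hf : DifferentiableOn ℂ f K) : ∃ Q : ℂ → ℂ, ∀ z ∈ K, HasDerivAt Q (f z) z := by
  -- Closedness of `f dz` is the symmetry of the bilinear map `(v, w) ↦ f' v w`.
  obtain ⟨Q, hQ⟩ := hK.exists_forall_hasFDerivWithinAt_of_hasFDerivWithinAt_symmetric
    (𝕜 := ℂ) (ω := fun z => ContinuousLinearMap.toSpanSingleton ℂ (f z))
    (dω := fun z => (((ContinuousLinearMap.toSpanSingletonCLE (𝕜 := ℂ) (E := ℂ) :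
      ℂ →L[ℂ] (ℂ →L[ℂ] ℂ)).comp (ContinuousLinearMap.toSpanSingleton ℂ (deriv f z)))).restrictScalars ℝ)
    (fun z hz => by
      have h1 : HasDerivAt f (deriv f z) z :=
        ((hf z hz).differentiableAt (hKo.mem_nhds hz)).hasDerivAt
      have h2 := (ContinuousLinearMap.toSpanSingletonCLE (𝕜 := ℂ) (E := ℂ) :
        ℂ →L[ℂ] (ℂ →L[ℂ] ℂ)).hasFDerivAt.comp z h1.hasFDerivAt
      exact (h2.restrictScalars ℝ).hasFDerivWithinAt)
    (fun a _ x _ y _ => by simp [mul_left_comm])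
  refine ⟨Q, fun z hz => ?_⟩
  have := (hQ z hz).hasFDerivAt (hKo.mem_nhds hz)
  simpa using this.hasDerivAt

open Filter in
/-- A potential of a pair of forms that extend holomorphically across a puncture. -/
theorem exists_analytic_of_hasFDerivAt_pairForm {Ψ α β : ℂ → ℂ} {s₀ : ℂ}
    (hα : AnalyticAt ℂ α s₀) (hβ : AnalyticAt ℂ β s₀)
    (hΨ : ∀ᶠ s in 𝓝[≠] s₀, HasFDerivAt Ψ (pairForm (α s) (β s)) s) :
    ∃ A B : ℂ → ℂ, (∀ᶠ s in 𝓝 s₀, HasDerivAt A (α s) s ∧ HasDerivAt B (β s) s) ∧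
      ∀ᶠ s in 𝓝[≠] s₀, Ψ s = A s - conj (B s) := by
  have hev : ∀ᶠ s in 𝓝 s₀, (AnalyticAt ℂ α s ∧ AnalyticAt ℂ β s) ∧
      (s ≠ s₀ → HasFDerivAt Ψ (pairForm (α s) (β s)) s) :=
    (hα.eventually_analyticAt.and hβ.eventually_analyticAt).and
      (eventually_nhdsWithin_iff.mp hΨ)
  obtain ⟨r, hr, hball⟩ := Metric.eventually_nhds_iff_ball.mp hev
  obtain ⟨A, hA⟩ := (convex_ball s₀ r).exists_primitive Metric.isOpen_ball
    (f := α) fun s hs => (hball s hs).1.1.differentiableAt.differentiableWithinAt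
  obtain ⟨B, hB⟩ := (convex_ball s₀ r).exists_primitive Metric.isOpen_ball
    (f := β) fun s hs => (hball s hs).1.2.differentiableAt.differentiableWithinAt
  have hopen : IsOpen (Metric.ball s₀ r \ {s₀}) := Metric.isOpen_ball.sdiff isClosed_singleton
  have hd : ∀ s ∈ Metric.ball s₀ r \ {s₀},
      HasFDerivAt (fun s => Ψ s - (A s - conj (B s))) (0 : ℂ →L[ℝ] ℂ) s := by
    rintro s ⟨hs, hne⟩
    have := ((hball s hs).2 hne).sub ((hA s hs).hasFDerivAt_pairForm (hB s hs))
    rwa [sub_self] at this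
  -- The punctured disc is connected although not simply connected, so the two functions differ by
  -- one constant, which is absorbed into `A`.
  obtain ⟨k, hk⟩ := hopen.exists_is_const_of_fderiv_eq_zero
    (Complex.isPreconnected_ball_diff_singleton s₀ r)
    (fun s hs => (hd s hs).differentiableAt.differentiableWithinAt)
    (fun s hs => (hd s hs).fderiv)
  refine ⟨fun s => A s + k, B, ?_, ?_⟩
  · filter_upwards [Metric.ball_mem_nhds s₀ hr] with s hs
    exact ⟨(hA s hs).add_const k, hB s hs⟩
  · filter_upwards [mem_nhdsWithin_of_mem_nhds (Metric.ball_mem_nhds s₀ hr),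
      self_mem_nhdsWithin] with s hs hne
    have := hk s ⟨hs, hne⟩
    linear_combination this

/-! ### The potential of the height differential -/

/-- The open set on which the potential of the height differential is defined. -/
abbrev RealPointsCompl {n : ℕ} (t : Fin n → ℝ) : Type := {z : ℂ // ∀ i, z ≠ (t i : ℂ)}

namespace RealPointsCompl

variable {n : ℕ} (t : Fin n → ℝ)

/-- The function `(z - t i) ^ k` on the complement of the points `t i`. -/
noncomputable def power (i : Fin n) (k : ℤ) : RealPointsCompl t → ℂ := fun z => (z.1 - t i) ^ k

/-- The real span of all integral powers of the functions `z - t i`. -/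
noncomputable def powerSpan : Submodule ℝ (RealPointsCompl t → ℂ) :=
  Submodule.span ℝ {f | ∃ i k, f = power t i k}

variable {t}

theorem power_mem (i : Fin n) (k : ℤ) : power t i k ∈ powerSpan t :=
  Submodule.subset_span ⟨i, k, rfl⟩

theorem sub_ne (z : RealPointsCompl t) (i : Fin n) : z.1 - (t i : ℂ) ≠ 0 := sub_ne_zero.mpr (z.2 i)

/-- `z - t j` is `z - t i` plus the real number `t i - t j`. Together with the next lemma this is
partial fractions over the reals. -/
theorem power_one_mul_mem (j i : Fin n) (k : ℤ) : power t j 1 * power t i k ∈ powerSpan t := by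
  have : power t j 1 * power t i k = power t i (k + 1) + (t i - t j : ℝ) • power t i k := by
    ext z
    simp only [power, Pi.mul_apply, Pi.add_apply, Pi.smul_apply, Complex.real_smul, zpow_one,
      zpow_add₀ (sub_ne z i)]
    push_cast
    ring
  rw [this]
  exact add_mem (power_mem _ _) (Submodule.smul_mem _ _ (power_mem _ _))

theorem power_neg_one_mul_mem (ht : Function.Injective t) (j i : Fin n) (k : ℤ) :
    power t j (-1) * power t i k ∈ powerSpan t := by
  rcases eq_or_ne j i with rfl | hji
  · have : power t j (-1) * power t j k = power t j (-1 + k) := by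
      ext z
      simp only [power, Pi.mul_apply, zpow_add₀ (sub_ne z j)]
    rw [this]
    exact power_mem _ _
  have hne : (t j - t i : ℝ) ≠ 0 := sub_ne_zero.mpr (ht.ne hji)
  -- This is `(z - t i) / (z - t j) = 1 + (t j - t i) / (z - t j)`. The induction uses it upwards as
  -- it stands and downwards after division by `t j - t i`.
  have key : ∀ k : ℤ, power t j (-1) * power t i (k + 1) =
      power t i k + (t j - t i : ℝ) • (power t j (-1) * power t i k) := by
    intro k
    ext z
    have h1 := sub_ne z j
    simp only [power, Pi.mul_apply, Pi.add_apply, Pi.smul_apply, Complex.real_smul, zpow_neg,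
      zpow_one, zpow_add₀ (sub_ne z i)]
    push_cast
    field_simp
    ring
  induction k with
  | zero =>
    have : power t j (-1) * power t i 0 = power t j (-1) := by ext z; simp [power]
    rw [this]
    exact power_mem _ _
  | succ k ih =>
    rw [key]
    exact add_mem (power_mem _ _) (Submodule.smul_mem _ _ ih)
  | pred k ih =>
    have h := key (-(k : ℤ) - 1)
    have h2 : power t j (-1) * power t i (-(k : ℤ) - 1) = (t j - t i : ℝ)⁻¹ •
        (power t j (-1) * power t i (-(k : ℤ)) - power t i (-(k : ℤ) - 1)) := by
      rw [show -(k : ℤ) - 1 + 1 = -(k : ℤ) by ring] at h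
      rw [h, add_sub_cancel_left, smul_smul, inv_mul_cancel₀ hne, one_smul]
    rw [h2]
    exact Submodule.smul_mem _ _ (sub_mem ih (power_mem _ _))

theorem mul_mem_powerSpan {g : RealPointsCompl t → ℂ}
    (hg : ∀ i k, g * power t i k ∈ powerSpan t) {f : RealPointsCompl t → ℂ}
    (hf : f ∈ powerSpan t) : g * f ∈ powerSpan t := by
  induction hf using Submodule.span_induction with
  | mem f hf => obtain ⟨i, k, rfl⟩ := hf; exact hg i k
  | zero => rw [mul_zero]; exact zero_mem _
  | add f f' _ _ h h' => rw [mul_add]; exact add_mem h h'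
  | smul a f _ h => rw [mul_smul_comm]; exact Submodule.smul_mem _ _ h

theorem power_mul_mem_powerSpan (ht : Function.Injective t) (i : Fin n) (k : ℤ)
    {f : RealPointsCompl t → ℂ} (hf : f ∈ powerSpan t) : power t i k * f ∈ powerSpan t := by
  induction k with
  | zero =>
    have : power t i 0 * f = f := by ext z; simp [power]
    rwa [this]
  | succ k ih =>
    have : power t i (k + 1) * f = power t i 1 * (power t i k * f) := by
      ext z
      simp only [power, Pi.mul_apply, zpow_add₀ (sub_ne z i)]
      ring
    rw [this]
    exact mul_mem_powerSpan (power_one_mul_mem i) ih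
  | pred k ih =>
    have : power t i (-(k : ℤ) - 1) * f = power t i (-1) * (power t i (-(k : ℤ)) * f) := by
      ext z
      simp only [power, Pi.mul_apply]
      rw [show -(k : ℤ) - 1 = -1 + -(k : ℤ) by ring, zpow_add₀ (sub_ne z i), mul_assoc]
    rw [this]
    exact mul_mem_powerSpan (power_neg_one_mul_mem ht i) ih

/-- Every element of the span has a potential: the residues are real. -/
theorem exists_potential_of_mem {f : RealPointsCompl t → ℂ} (hf : f ∈ powerSpan t) :
    ∃ ψ : ℂ → ℂ, ∀ z : RealPointsCompl t, HasFDerivAt ψ (pairForm (f z) (-f z)) z.1 := by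
  induction hf using Submodule.span_induction with
  | mem f hf =>
    obtain ⟨i, k, rfl⟩ := hf
    rcases eq_or_ne k (-1) with rfl | hk
    -- The residue term: twice the real part of `log (z - t i)` is `log |z - t i| ^ 2`, which is
    -- single-valued.
    · refine ⟨fun z => ((Real.log (Complex.normSq (z - t i)) : ℝ) : ℂ), fun z => ?_⟩
      have hz := sub_ne z i
      have h0 : HasFDerivAt (fun w : ℂ => (w - t i) * conj (w - t i))
          ((z.1 - t i) • ((Complex.conjCLE : ℂ →L[ℝ] ℂ)) +
            (conj (z.1 - t i)) • (ContinuousLinearMap.id ℝ ℂ)) z.1 := by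
        have h1 : HasFDerivAt (fun w : ℂ => w - t i) (ContinuousLinearMap.id ℝ ℂ) z.1 :=
          (hasFDerivAt_id z.1).sub_const _
        have h2 := (Complex.conjCLE : ℂ →L[ℝ] ℂ).hasFDerivAt.comp z.1 h1
        exact h1.mul h2
      have h3 := Complex.reCLM.hasFDerivAt.comp z.1 h0
      have h4 : (Complex.reCLM ∘ fun w : ℂ => (w - t i) * conj (w - t i)) =
          fun w => Complex.normSq (w - t i) := by
        ext w; simp [Complex.normSq_apply]
      rw [h4] at h3
      have h5 := (h3.log (Complex.normSq_pos.mpr hz).ne')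
      have h6 := Complex.ofRealCLM.hasFDerivAt.comp z.1 h5
      refine HasFDerivAt.congr_fderiv h6 ?_
      ext v
      have hn : ((Complex.normSq (z.1 - t i) : ℝ) : ℂ) = (z.1 - t i) * conj (z.1 - t i) :=
        (Complex.mul_conj _).symm
      have hcz : conj (z.1 - (t i : ℂ)) ≠ 0 := (map_ne_zero _).mpr hz
      have hre : (((((z.1 - t i) * conj v + conj (z.1 - t i) * v).re) : ℝ) : ℂ) =
          (z.1 - t i) * conj v + conj (z.1 - t i) * v := by
        rw [Complex.re_eq_add_conj]
        simp only [map_add, map_mul, Complex.conj_conj]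
        ring
      have hL : ∀ v : ℂ, (Complex.ofRealCLM.comp ((Complex.normSq (z.1 - t i))⁻¹ •
          Complex.reCLM.comp ((z.1 - t i) • ((Complex.conjCLE : ℂ →L[ℝ] ℂ)) +
            (conj (z.1 - t i)) • (ContinuousLinearMap.id ℝ ℂ)))) v =
          ((Complex.normSq (z.1 - t i) : ℝ) : ℂ)⁻¹ *
          (((((z.1 - t i) * conj v + conj (z.1 - t i) * v).re) : ℝ) : ℂ) := by
        intro v
        simp [-Complex.sub_re, -Complex.mul_re, -Complex.conj_re, mul_add]
      rw [hL, hre, hn]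
      simp only [pairForm_apply, power, map_mul, map_neg, zpow_neg, zpow_one, map_inv₀]
      field_simp
      ring
    · have hk1 : ((k + 1 : ℤ) : ℂ) ≠ 0 := by
        exact_mod_cast (by omega : k + 1 ≠ 0)
      refine ⟨fun z => (z - t i) ^ (k + 1) / ((k + 1 : ℤ) : ℂ) -
        conj (-((z - t i) ^ (k + 1) / ((k + 1 : ℤ) : ℂ))), fun z => ?_⟩
      have h1 : HasDerivAt (fun z : ℂ => (z - t i) ^ (k + 1) / ((k + 1 : ℤ) : ℂ))
          (power t i k z) z.1 := by
        have h2 := (hasDerivAt_zpow (k + 1) (z.1 - t i) (Or.inl (sub_ne z i))).comp z.1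
          ((hasDerivAt_id z.1).sub_const (t i : ℂ))
        have h3 := h2.div_const ((k + 1 : ℤ) : ℂ)
        refine h3.congr_deriv ?_
        simp only [power, add_sub_cancel_right, mul_one]
        field_simp
      exact h1.hasFDerivAt_pairForm h1.neg
  | zero =>
    refine ⟨0, fun z => (hasFDerivAt_const (0 : ℂ) z.1).congr_fderiv ?_⟩
    ext v; simp
  | add f f' _ _ h h' =>
    obtain ⟨ψ, h⟩ := h
    obtain ⟨ψ', h'⟩ := h'
    refine ⟨ψ + ψ', fun z => ((h z).add (h' z)).congr_fderiv ?_⟩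
    ext v
    simp [add_mul]
    ring
  | smul a f _ h =>
    -- Only a real factor commutes with the conjugation in `pairForm`; this is why the span is taken
    -- over the reals.
    obtain ⟨ψ, h⟩ := h
    refine ⟨a • ψ, fun z => ((h z).const_smul a).congr_fderiv ?_⟩
    ext v
    simp
    ring

end RealPointsCompl

/-- The form `∏ (z - t i) ^ k i dz` with real points `t i` has a single-valued real part of its
integral. -/
theorem exists_height_potential {n : ℕ} {t : Fin n → ℝ} (ht : Function.Injective t)
    (hn : 0 < n) (k : Fin n → ℤ) :
    ∃ ψ : ℂ → ℂ, ∀ z : ℂ, (∀ i, z ≠ t i) →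
      HasFDerivAt ψ (pairForm (∏ i, (z - t i) ^ k i) (-∏ i, (z - t i) ^ k i)) z := by
  have hmem : ∀ s : Finset (Fin n),
      (∏ i ∈ s, RealPointsCompl.power t i (k i)) ∈ RealPointsCompl.powerSpan t := by
    intro s
    induction s using Finset.induction_on with
    | empty =>
      have : (1 : RealPointsCompl t → ℂ) = RealPointsCompl.power t ⟨0, hn⟩ 0 := by
        ext z; simp [RealPointsCompl.power]
      rw [Finset.prod_empty, this]
      exact RealPointsCompl.power_mem _ _
    | insert i s hi ih =>
      rw [Finset.prod_insert hi]
      exact RealPointsCompl.power_mul_mem_powerSpan ht i (k i) ih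
  obtain ⟨ψ, hψ⟩ := RealPointsCompl.exists_potential_of_mem (hmem Finset.univ)
  refine ⟨ψ, fun z hz => ?_⟩
  simpa [RealPointsCompl.power] using hψ ⟨z, hz⟩

/-! ### Branches of the hyperelliptic square root -/

section Branches

variable {n : ℕ} (t : Fin n → ℝ)

/-- The branch of `∏ (z - t i) ^ (1 / 2)` on the closed upper half-plane. -/
noncomputable def sqrtUpper (z : ℂ) : ℂ := ∏ i, (z - t i) ^ ((1 : ℂ) / 2)

/-- The branch of `∏ (z - t i) ^ (1 / 2)` that is holomorphic near the real point `x`. -/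
noncomputable def sqrtNear (x : ℝ) (z : ℂ) : ℂ :=
  ∏ i, if t i < x then (z - t i) ^ ((1 : ℂ) / 2) else Complex.I * (t i - z) ^ ((1 : ℂ) / 2)

/-- The sign of `∏ (x - t i)`. -/
noncomputable def realSign (x : ℝ) : ℝ := ∏ i, if t i < x then 1 else -1

/-- The plane without the real points in the intervals adjacent to the one of `x`. -/
def slitDomain (x : ℝ) : Set ℂ :=
  {z | ∀ i, if t i < x then z - t i ∈ Complex.slitPlane else t i - z ∈ Complex.slitPlane}

theorem Complex.cpow_half_sq (w : ℂ) : (w ^ ((1 : ℂ) / 2)) ^ 2 = w := by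
  simp

theorem sqrtUpper_sq (z : ℂ) : sqrtUpper t z ^ 2 = ∏ i, (z - (t i : ℂ)) := by
  rw [sqrtUpper, ← Finset.prod_pow]
  exact Finset.prod_congr rfl fun i _ => Complex.cpow_half_sq _

theorem sqrtNear_sq (x : ℝ) (z : ℂ) : sqrtNear t x z ^ 2 = ∏ i, (z - (t i : ℂ)) := by
  rw [sqrtNear, ← Finset.prod_pow]
  refine Finset.prod_congr rfl fun i _ => ?_
  split_ifs
  · exact Complex.cpow_half_sq _
  · rw [mul_pow, Complex.cpow_half_sq, Complex.I_sq]; ring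

/-- On the closed upper half-plane without the nonnegative reals, `arg w = arg (-w) + π`, and
halving the argument turns `π` into the factor `I`. The negative reals are included because the
principal argument there is `π`. -/
theorem Complex.cpow_half_eq_I_mul {w : ℂ} (h0 : w ≠ 0) (him : 0 ≤ w.im)
    (hw : -w ∈ Complex.slitPlane) : w ^ ((1 : ℂ) / 2) = Complex.I * (-w) ^ ((1 : ℂ) / 2) := by
  have hlog : Complex.log w = Complex.log (-w) + Real.pi * Complex.I := by
    apply Complex.ext
    · simp [Complex.log_re]
    · simp only [Complex.log_im, Complex.add_im, Complex.mul_im, Complex.ofReal_re, Complex.I_im,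
        mul_one, Complex.ofReal_im, Complex.I_re, mul_zero, add_zero]
      rcases him.lt_or_eq with h | h
      · have := Complex.arg_neg_eq_arg_sub_pi_of_im_pos h
        linarith
      · have h2 : w = ((w.re : ℝ) : ℂ) := Complex.ext (by simp) (by simp [← h])
        have h3 : w.re < 0 := by
          rcases hw with h4 | h4
          · simpa using h4
          · simp [← h] at h4
        rw [h2, ← Complex.ofReal_neg, Complex.arg_ofReal_of_neg h3,
          Complex.arg_ofReal_of_nonneg (by linarith)]
        simp
  rw [Complex.cpow_def_of_ne_zero h0, Complex.cpow_def_of_ne_zero (neg_ne_zero.mpr h0), hlog,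
    add_mul, Complex.exp_add, mul_comm]
  congr 1
  rw [show (Real.pi : ℂ) * Complex.I * (1 / 2) = Real.pi / 2 * Complex.I by ring]
  exact Complex.exp_pi_div_two_mul_I

variable {t}

theorem isOpen_slitDomain (x : ℝ) : IsOpen (slitDomain t x) := by
  simp only [slitDomain, Set.ofPred_forall]
  refine isOpen_iInter_of_finite fun i => ?_
  split_ifs
  · exact Complex.isOpen_slitPlane.preimage (continuous_id.sub continuous_const)
  · exact Complex.isOpen_slitPlane.preimage (continuous_const.sub continuous_id)

theorem mem_slitDomain {x : ℝ} (hx : ∀ i, x ≠ t i) : (x : ℂ) ∈ slitDomain t x := by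
  intro i
  split_ifs with h
  · left; simpa using h
  · left; simpa using lt_of_le_of_ne (not_lt.mp h) (hx i)

theorem conj_mem_slitDomain {x : ℝ} {z : ℂ} (hz : z ∈ slitDomain t x) :
    conj z ∈ slitDomain t x := by
  intro i
  have := hz i
  split_ifs at this ⊢ <;> simpa [Complex.mem_slitPlane_iff] using this

theorem ne_of_mem_slitDomain {x : ℝ} {z : ℂ} (hz : z ∈ slitDomain t x) (i : Fin n) :
    z ≠ t i := by
  rintro rfl
  have := hz i
  split_ifs at this <;> simp at this

/-- The factors with `t i` to the right of `x` have their cut running through `x`; `sqrtNear` turns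
these cuts to the right. It thus continues `sqrtUpper` analytically across the edge of `x`. -/
theorem sqrtNear_eq_sqrtUpper {x : ℝ} {z : ℂ} (hz : z ∈ slitDomain t x) (him : 0 ≤ z.im) :
    sqrtNear t x z = sqrtUpper t z := by
  refine Finset.prod_congr rfl fun i _ => ?_
  have h := hz i
  split_ifs at h ⊢
  · rfl
  · rw [Complex.cpow_half_eq_I_mul (sub_ne_zero.mpr (ne_of_mem_slitDomain hz i)) (by simpa using him)
      (by simpa using h), neg_sub]

/-- Square roots with principal cut commute with conjugation off the cut, so only the factors `I`
change sign, one for each `t i` to the right. -/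
theorem conj_sqrtNear {x : ℝ} {z : ℂ} (hz : z ∈ slitDomain t x) :
    conj (sqrtNear t x (conj z)) = realSign t x * sqrtNear t x z := by
  have key : ∀ w : ℂ, w ∈ Complex.slitPlane →
      conj ((conj w) ^ ((1 : ℂ) / 2)) = w ^ ((1 : ℂ) / 2) := by
    intro w hw
    have h2 := Complex.cpow_conj w ((1 : ℂ) / 2) (Complex.slitPlane_arg_ne_pi hw)
    have h3 : conj ((1 : ℂ) / 2) = 1 / 2 := by simp [Complex.ext_iff]
    rw [h3] at h2
    exact h2.symm
  rw [sqrtNear, sqrtNear, realSign, map_prod, Complex.ofReal_prod, ← Finset.prod_mul_distrib]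
  refine Finset.prod_congr rfl fun i _ => ?_
  have h := hz i
  split_ifs at h ⊢
  · have := key _ h
    simpa using this
  · have := key _ h
    simp only [map_sub, Complex.conj_ofReal] at this
    simp only [map_mul, Complex.conj_I, this]
    push_cast; ring

theorem differentiableOn_sqrtNear (x : ℝ) : DifferentiableOn ℂ (sqrtNear t x) (slitDomain t x) := by
  intro z hz
  refine DifferentiableAt.differentiableWithinAt ?_
  unfold sqrtNear
  refine DifferentiableAt.fun_finsetProd fun i _ => ?_
  have h := hz i
  split_ifs at h ⊢
  · exact (differentiableAt_id.sub_const _).cpow_const h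
  · exact ((differentiableAt_const _).sub differentiableAt_id).cpow_const h |>.const_mul _

theorem differentiableAt_sqrtUpper {z : ℂ} (him : 0 < z.im) :
    DifferentiableAt ℂ (sqrtUpper t) z := by
  unfold sqrtUpper
  refine DifferentiableAt.fun_finsetProd fun i _ => ?_
  exact (differentiableAt_id.sub_const _).cpow_const (Or.inr (by simpa using him.ne'))

theorem realSign_sq (x : ℝ) : realSign t x ^ 2 = 1 := by
  rw [realSign, ← Finset.prod_pow]
  refine Finset.prod_eq_one fun i _ => ?_
  split_ifs <;> norm_num

theorem sqrtUpper_ne_zero {z : ℂ} (hz : ∀ i, z ≠ t i) : sqrtUpper t z ≠ 0 := by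
  intro h
  have := sqrtUpper_sq t z
  rw [h] at this
  exact Finset.prod_ne_zero_iff.mpr (fun i _ => sub_ne_zero.mpr (hz i)) (by simpa using this.symm)

end Branches

/-! ### The reflection principle on the double cover. -/

theorem pairForm_real_smul (s : ℝ) (a b : ℂ) :
    s • pairForm a b = pairForm (s * a) (s * b) := by
  ext v; simp; ring

theorem HasFDerivAt.conj_comp_conj {f : ℂ → ℂ} {a b z : ℂ}
    (h : HasFDerivAt f (pairForm a b) (conj z)) :
    HasFDerivAt (fun w => conj (f (conj w))) (pairForm (conj a) (conj b)) z := by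
  have h1 : HasFDerivAt (fun w : ℂ => conj w) (Complex.conjCLE : ℂ →L[ℝ] ℂ) z :=
    (Complex.conjCLE : ℂ →L[ℝ] ℂ).hasFDerivAt
  have h2 := h.comp z h1
  have h3 := (Complex.conjCLE : ℂ →L[ℝ] ℂ).hasFDerivAt.comp z h2
  refine h3.congr_fderiv ?_
  ext v; simp

/-- Reflection principle: a function on the closed upper half-plane, minus the points `t i`, whose
differential is the form `y r₁ dz - conj (y r₂ dz)`, and which has the values on the real edges
required by the reflections, extends to the double cover `y ^ 2 = ∏ (z - t i)`. -/
theorem exists_double_cover_extension {n : ℕ} {t : Fin n → ℝ} {r₁ r₂ : ℂ → ℂ}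
    (hr₁ : ∀ z, r₁ (conj z) = conj (r₁ z)) (hr₂ : ∀ z, r₂ (conj z) = conj (r₂ z)) {E₀ : ℂ → ℂ}
    (hU : ∀ z : ℂ, 0 < z.im →
      HasFDerivAt E₀ (pairForm (sqrtUpper t z * r₁ z) (sqrtUpper t z * r₂ z)) z)
    (hR : ∀ x : ℝ, (∀ i, x ≠ t i) → E₀ x = realSign t x * conj (E₀ x) ∧
      ∃ F : ℂ → ℂ, ∀ᶠ z in 𝓝 (x : ℂ),
        HasFDerivAt F (pairForm (sqrtNear t x z * r₁ z) (sqrtNear t x z * r₂ z)) z ∧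
        (0 ≤ z.im → E₀ z = F z)) :
    ∃ E : ℂ → ℂ → ℂ, (∀ z y, E z (-y) = -E z y) ∧
      ∀ z y, y ^ 2 = ∏ i, (z - (t i : ℂ)) → y ≠ 0 → ∃ Y : ℂ → ℂ, ContinuousAt Y z ∧ Y z = y ∧
        (∀ᶠ w in 𝓝 z, Y w ^ 2 = ∏ i, (w - (t i : ℂ))) ∧
        HasFDerivAt (fun w => E w (Y w)) (pairForm (y * r₁ z) (y * r₂ z)) z := by
  -- The quotient `y / sqrtUpper t z` is the sign of the sheet. Below the real line the definition
  -- is the reflection `E z y = conj (E (conj z) (conj y))`.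
  set E : ℂ → ℂ → ℂ := fun z y => if 0 ≤ z.im then y / sqrtUpper t z * E₀ z
    else conj (conj y / sqrtUpper t (conj z) * E₀ (conj z)) with hE
  refine ⟨E, fun z y => ?_, fun z y hy hy0 => ?_⟩
  · simp only [hE]
    split_ifs
    · ring
    · simp only [map_neg, map_mul, map_div₀]; ring
  -- The given `y` and a local branch have equal squares. Their quotient `±1` is kept as a real
  -- number so that it passes through conjugation and `pairForm`.
  have hsign : ∀ u v : ℂ, u ^ 2 = v ^ 2 → v ≠ 0 → ∃ s : ℝ, u = s * v := by
    intro u v huv hv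
    rcases sq_eq_sq_iff_eq_or_eq_neg.mp huv with h | h
    · exact ⟨1, by simpa using h⟩
    · exact ⟨-1, by simpa using h⟩
  have hsign2 : ∀ u v : ℂ, ∀ s : ℝ, u ^ 2 = v ^ 2 → v ≠ 0 → u = s * v → (s : ℂ) ^ 2 = 1 := by
    intro u v s huv hv h
    rw [h, mul_pow] at huv
    exact mul_right_cancel₀ (pow_ne_zero 2 hv) (by rw [huv, one_mul])
  have hne : ∀ i, z ≠ t i := by
    intro i hi
    apply hy0
    rw [← sq_eq_zero_iff, hy]
    exact Finset.prod_eq_zero (Finset.mem_univ i) (by rw [hi, sub_self])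
  rcases lt_trichotomy z.im 0 with him | him | him
  · -- the lower half-plane
    have him' : 0 < (conj z).im := by simpa using him
    have hne' : ∀ i, conj z ≠ t i := fun i h => hne i (by rw [← Complex.conj_conj z, h]; simp)
    have hY0 := sqrtUpper_ne_zero hne'
    have hsq : (conj y) ^ 2 = sqrtUpper t (conj z) ^ 2 := by
      rw [sqrtUpper_sq, ← map_pow, hy, map_prod]; simp
    obtain ⟨s, hs⟩ := hsign _ _ hsq hY0
    have hs2 := hsign2 _ _ s hsq hY0 hs
    refine ⟨fun w => conj (s * sqrtUpper t (conj w)), ?_, ?_, ?_, ?_⟩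
    · have h1 : ContinuousAt (sqrtUpper t) (conj z) :=
        (differentiableAt_sqrtUpper him').continuousAt
      have h2 : ContinuousAt (fun w => sqrtUpper t (conj w)) z :=
        ContinuousAt.comp (f := fun w => conj w) h1 Complex.continuous_conj.continuousAt
      exact Complex.continuous_conj.continuousAt.comp (continuousAt_const.mul h2)
    · simp only [← hs, Complex.conj_conj]
    · refine Filter.Eventually.of_forall fun w => ?_
      rw [← map_pow, mul_pow, hs2, sqrtUpper_sq, map_mul, map_prod]; simp
    · have h1 := (hU _ him').const_smul s
      rw [pairForm_real_smul, ← mul_assoc, ← mul_assoc, ← hs] at h1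
      have h2 := h1.conj_comp_conj
      simp only [map_mul, hr₁, hr₂, Complex.conj_conj] at h2
      refine h2.congr_of_eventuallyEq ?_
      filter_upwards [(isOpen_lt Complex.continuous_im continuous_const).mem_nhds him] with w hw
      have hw' : w.im < 0 := hw
      have hw0 : sqrtUpper t (conj w) ≠ 0 := sqrtUpper_ne_zero fun i h => by
        have := congrArg Complex.im h
        simp at this
        exact hw'.ne this
      simp only [hE, if_neg (not_le.mpr hw'), Pi.smul_apply, Complex.real_smul, Complex.conj_conj]
      rw [mul_div_assoc, div_self hw0, mul_one]
  · -- the real line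
    obtain ⟨x, rfl⟩ : ∃ x : ℝ, z = x := ⟨z.re, Complex.ext (by simp) (by simp [him])⟩
    have hx : ∀ i, x ≠ t i := fun i h => hne i (by rw [h])
    obtain ⟨hE₀, F, hF⟩ := hR x hx
    have hmem := mem_slitDomain hx
    have hY0 : sqrtNear t x x ≠ 0 := by
      rw [sqrtNear_eq_sqrtUpper hmem (by simp)]; exact sqrtUpper_ne_zero hne
    have hsq : y ^ 2 = sqrtNear t x x ^ 2 := by rw [sqrtNear_sq, hy]
    obtain ⟨s, hs⟩ := hsign _ _ hsq hY0
    have hs2 := hsign2 _ _ s hsq hY0 hs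
    obtain ⟨r, hr, hball⟩ := Metric.eventually_nhds_iff_ball.mp
      (hF.and ((isOpen_slitDomain x).mem_nhds hmem))
    have hconj : ∀ w ∈ Metric.ball (x : ℂ) r, conj w ∈ Metric.ball (x : ℂ) r := by
      intro w hw
      have h1 : conj w - x = conj (w - x) := by simp
      rw [mem_ball_iff_norm] at hw ⊢
      rwa [h1, Complex.norm_conj]
    have hS2 : (realSign t x : ℂ) * realSign t x = 1 := by
      rw [← sq]; exact_mod_cast realSign_sq x
    -- By `conj_sqrtNear`, `F` and its reflection have the same differential on the ball. They agree
    -- at `x` by the boundary condition, hence everywhere on the ball.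
    have hrefl : ∀ w ∈ Metric.ball (x : ℂ) r, F w = realSign t x * conj (F (conj w)) := by
      have hd : ∀ w ∈ Metric.ball (x : ℂ) r,
          HasFDerivAt (fun w => F w - realSign t x • conj (F (conj w))) (0 : ℂ →L[ℝ] ℂ) w := by
        intro w hw
        have h1 := ((hball _ (hconj w hw)).1.1.conj_comp_conj).const_smul (realSign t x)
        rw [pairForm_real_smul, map_mul, map_mul, conj_sqrtNear (hball w hw).2, hr₁, hr₂,
          Complex.conj_conj, Complex.conj_conj, mul_assoc, mul_assoc, ← mul_assoc, hS2, one_mul,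
          ← mul_assoc, hS2, one_mul] at h1
        have h2 := (hball w hw).1.1.sub h1
        rwa [sub_self] at h2
      intro w hw
      have h1 := Metric.isOpen_ball.is_const_of_fderiv_eq_zero
        (convex_ball (x : ℂ) r).isPreconnected
        (fun w hw => (hd w hw).differentiableAt.differentiableWithinAt)
        (fun w hw => (hd w hw).fderiv) hw (Metric.mem_ball_self hr)
      have h3 := (hball x (Metric.mem_ball_self hr)).1.2 (by simp)
      simp only [Complex.conj_ofReal, Complex.real_smul, ← h3, ← hE₀, sub_self] at h1
      exact sub_eq_zero.mp h1
    refine ⟨fun w => s * sqrtNear t x w, ?_, hs.symm, ?_, ?_⟩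
    · exact continuousAt_const.mul ((differentiableOn_sqrtNear x).differentiableAt
        ((isOpen_slitDomain x).mem_nhds hmem)).continuousAt
    · refine Filter.Eventually.of_forall fun w => ?_
      rw [mul_pow, hs2, sqrtNear_sq, one_mul]
    · have h1 := ((hball x (Metric.mem_ball_self hr)).1.1).const_smul s
      rw [pairForm_real_smul, ← mul_assoc, ← mul_assoc, ← hs] at h1
      refine h1.congr_of_eventuallyEq ?_
      filter_upwards [Metric.ball_mem_nhds (x : ℂ) hr] with w hw
      obtain ⟨⟨-, hw1⟩, hw2⟩ := hball w hw
      simp only [hE, Pi.smul_apply, Complex.real_smul]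
      split_ifs with hw'
      · rw [hw1 hw', sqrtNear_eq_sqrtUpper hw2 hw', mul_div_assoc, div_self, mul_one]
        exact sqrtUpper_ne_zero (ne_of_mem_slitDomain hw2)
      · have hw'' : 0 ≤ (conj w).im := by simpa using (not_le.mp hw').le
        have hcw := conj_mem_slitDomain hw2
        have h4 : conj (sqrtNear t x w) = realSign t x * sqrtUpper t (conj w) := by
          have := conj_sqrtNear hcw
          rwa [Complex.conj_conj, sqrtNear_eq_sqrtUpper hcw hw''] at this
        have hw0 : sqrtUpper t (conj w) ≠ 0 := sqrtUpper_ne_zero (ne_of_mem_slitDomain hcw)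
        -- Crossing the edge on the sheet of `sqrtNear` changes the sheet sign by `realSign`, and
        -- `hrefl` supplies the same sign for `F`. So the formula in the lower half-plane continues
        -- `s * F`.
        have h5 : conj (s * sqrtNear t x w) / sqrtUpper t (conj w) = s * realSign t x := by
          rw [map_mul, h4, Complex.conj_ofReal]
          field_simp
        rw [(hball _ (hconj w hw)).1.2 hw'', h5, map_mul, map_mul, Complex.conj_ofReal,
          Complex.conj_ofReal, mul_assoc, ← hrefl w hw]
  · -- the upper half-plane
    have hY0 := sqrtUpper_ne_zero hne
    have hsq : y ^ 2 = sqrtUpper t z ^ 2 := by rw [sqrtUpper_sq, hy]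
    obtain ⟨s, hs⟩ := hsign _ _ hsq hY0
    have hs2 := hsign2 _ _ s hsq hY0 hs
    refine ⟨fun w => s * sqrtUpper t w, ?_, hs.symm, ?_, ?_⟩
    · exact continuousAt_const.mul (differentiableAt_sqrtUpper him).continuousAt
    · refine Filter.Eventually.of_forall fun w => ?_
      rw [mul_pow, hs2, sqrtUpper_sq, one_mul]
    · have h1 := (hU _ him).const_smul s
      rw [pairForm_real_smul, ← mul_assoc, ← mul_assoc, ← hs] at h1
      refine h1.congr_of_eventuallyEq ?_
      filter_upwards [(isOpen_lt continuous_const Complex.continuous_im).mem_nhds him] with w hw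
      have hw' : 0 < w.im := hw
      have hw0 : sqrtUpper t w ≠ 0 := sqrtUpper_ne_zero fun i h => by
        rw [h] at hw'; simp at hw'
      simp only [hE, if_pos hw'.le, Pi.smul_apply, Complex.real_smul]
      rw [mul_div_assoc, div_self hw0, mul_one]

/-! ### The developing maps -/

namespace ConformalPolygon

variable {n : ℕ} (P : ConformalPolygon n)

/-- Exactly `n - j` vertices lie to the right of edge `j`, each contributing `-1`. Hence `realSign`
detects the parity of the index, which is what decides in `ConjugateAlong` which edges are parallel.
-/
theorem exists_mem_edge {x : ℝ} (hx : ∀ i, x ≠ P.t i) :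
    ∃ j : Fin (n + 1), x ∈ P.edge j ∧ realSign P.t x = (-1) ^ (n - (j : ℕ)) := by
  classical
  have hex : ∃ j : ℕ, ∀ i : Fin n, j ≤ i → x < P.t i := ⟨n, fun i hi => absurd hi (by omega)⟩
  set j := Nat.find hex with hj
  have hjn : j ≤ n := Nat.find_min' hex fun i hi => absurd hi (by omega)
  have hge : ∀ i : Fin n, j ≤ i → x < P.t i := Nat.find_spec hex
  have hlt : ∀ i : Fin n, (i : ℕ) < j → P.t i < x := by
    intro i hi
    have h1 := Nat.find_min hex (m := j - 1) (by omega)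
    push Not at h1
    obtain ⟨k, hk, hkx⟩ := h1
    have hkj : (k : ℕ) < j := by
      by_contra h
      exact absurd (hge k (by omega)) (not_lt.mpr hkx)
    refine lt_of_le_of_ne (le_trans (P.strictMono.monotone ?_) hkx) (hx i).symm
    rw [Fin.le_def]; omega
  refine ⟨⟨j, by omega⟩, fun i => ⟨hlt i, hge i⟩, ?_⟩
  have h2 : ∀ i : Fin n, (if P.t i < x then (1 : ℝ) else -1) = if (i : ℕ) < j then 1 else -1 := by
    intro i
    by_cases hi : (i : ℕ) < j
    · rw [if_pos hi, if_pos (hlt i hi)]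
    · rw [if_neg hi, if_neg (not_lt.mpr (hge i (by omega)).le)]
  rw [realSign, Finset.prod_congr rfl fun i _ => h2 i,
    Fin.prod_univ_eq_prod_range (fun i => if i < j then (1 : ℝ) else -1) n,
    ← Finset.prod_range_mul_prod_Ico _ hjn, Finset.prod_eq_one, one_mul,
    Finset.prod_congr rfl (g := fun _ => (-1 : ℝ))]
  · simp
  · intro i hi; rw [if_neg (by simp at hi; omega)]
  · intro i hi; rw [if_pos (by simpa using hi)]

theorem exists_mem_last_edge : ∃ p : ℝ, (∀ i, P.t i < p) ∧ p ∈ P.edge (Fin.last n) := by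
  obtain ⟨b, hb⟩ := (Set.finite_range P.t).bddAbove
  have h : ∀ i, P.t i < b + 1 := fun i => by linarith [hb ⟨i, rfl⟩]
  exact ⟨b + 1, h, fun i => ⟨fun _ => h i, fun hi => absurd hi (by simp)⟩⟩

/-- A convex neighborhood of `x` and `I` whose real points lie in the edge of `x`. -/
def wedge (x : ℝ) : Set ℂ :=
  {z | ∀ i, if P.t i < x then 0 < z.re - P.t i + (1 + |P.t i|) * z.im
    else z.re - P.t i - (1 + |P.t i|) * z.im < 0}

theorem convex_wedge (x : ℝ) : Convex ℝ (P.wedge x) := by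
  simp only [wedge, Set.ofPred_forall]
  refine convex_iInter fun i => ?_
  split_ifs
  · have h : IsLinearMap ℝ fun z : ℂ => z.re + (1 + |P.t i|) * z.im :=
      ⟨fun z w => by simp; ring, fun r z => by simp; ring⟩
    have h2 := convex_halfSpace_gt h (P.t i)
    rwa [show {z : ℂ | P.t i < z.re + (1 + |P.t i|) * z.im} =
        {z : ℂ | 0 < z.re - P.t i + (1 + |P.t i|) * z.im} from
      by ext z; simp only [Set.mem_ofPred_eq]; constructor <;> intro h <;> linarith] at h2
  · have h : IsLinearMap ℝ fun z : ℂ => z.re - (1 + |P.t i|) * z.im :=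
      ⟨fun z w => by simp; ring, fun r z => by simp; ring⟩
    have h2 := convex_halfSpace_lt h (P.t i)
    rwa [show {z : ℂ | z.re - (1 + |P.t i|) * z.im < P.t i} =
        {z : ℂ | z.re - P.t i - (1 + |P.t i|) * z.im < 0} from
      by ext z; simp only [Set.mem_ofPred_eq]; constructor <;> intro h <;> linarith] at h2

theorem isOpen_wedge (x : ℝ) : IsOpen (P.wedge x) := by
  simp only [wedge, Set.ofPred_forall]
  refine isOpen_iInter_of_finite fun i => ?_
  split_ifs
  · exact isOpen_lt (by fun_prop) (by fun_prop)
  · exact isOpen_lt (by fun_prop) (by fun_prop)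

/-- The slope `1 + |t i|` is chosen for this: at `I` the two inequalities become `t i < 1 + |t i|`
and `-t i < 1 + |t i|`. -/
theorem I_mem_wedge (x : ℝ) : Complex.I ∈ P.wedge x := by
  intro i
  have := abs_le.mp (le_refl |P.t i|)
  split_ifs <;> simp <;> linarith

theorem mem_wedge {x : ℝ} (hx : ∀ i, x ≠ P.t i) : (x : ℂ) ∈ P.wedge x := by
  intro i
  split_ifs with h
  · simpa using h
  · simpa using lt_of_le_of_ne (not_lt.mp h) (hx i)

theorem wedge_subset_slitDomain (x : ℝ) : P.wedge x ⊆ slitDomain P.t x := by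
  intro z hz i
  have := hz i
  split_ifs at this ⊢
  · rw [Complex.mem_slitPlane_iff]
    by_contra! h
    simp at h
    rw [h.2] at this
    linarith
  · rw [Complex.mem_slitPlane_iff]
    by_contra! h
    simp at h
    rw [h.2] at this
    linarith

end ConformalPolygon

namespace Orthodisk

variable {n : ℕ} {P : ConformalPolygon n}

/-- The rational factor `∏ (z - t i) ^ ((a i - 1) / 2)` of the canonical form. -/
noncomputable def ratFactor (X : Orthodisk P) (z : ℂ) : ℂ :=
  ∏ i, (z - (P.t i : ℂ)) ^ ((X.a i - 1) / 2)

theorem integrand_eq (X : Orthodisk P) {z : ℂ} (hz : ∀ i, z ≠ P.t i) :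
    X.integrand z = X.scale * (sqrtUpper P.t z * X.ratFactor z) := by
  unfold integrand sqrtUpper ratFactor
  rw [← Finset.prod_mul_distrib]
  congr 1
  refine Finset.prod_congr rfl fun i _ => ?_
  obtain ⟨k, hk⟩ := X.odd_a i
  have h1 : (X.a i - 1) / 2 = k := by omega
  rw [h1, ← Complex.cpow_intCast, ← Complex.cpow_add _ _ (sub_ne_zero.mpr (hz i)), hk]
  congr 1
  push_cast
  ring

theorem ratFactor_conj (X : Orthodisk P) (z : ℂ) : X.ratFactor (conj z) = conj (X.ratFactor z) := by
  simp [ratFactor, map_prod, map_zpow₀]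

theorem ratFactor_ne_zero (X : Orthodisk P) {z : ℂ} (hz : ∀ i, z ≠ P.t i) :
    X.ratFactor z ≠ 0 :=
  Finset.prod_ne_zero_iff.mpr fun i _ => zpow_ne_zero _ (sub_ne_zero.mpr (hz i))

theorem differentiableAt_ratFactor (X : Orthodisk P) {z : ℂ} (hz : ∀ i, z ≠ P.t i) :
    DifferentiableAt ℂ X.ratFactor z := by
  unfold ratFactor
  refine DifferentiableAt.fun_finsetProd fun i _ => ?_
  exact (differentiableAt_id.sub_const _).zpow (Or.inl (sub_ne_zero.mpr (hz i)))

/-- On a convex domain, the developing map is a primitive of an extension of its integrand. -/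
theorem exists_primitive_develop (X : Orthodisk P) {K : Set ℂ} (hK : Convex ℝ K) (hKo : IsOpen K)
    (hI : Complex.I ∈ K) {f : ℂ → ℂ} (hf : DifferentiableOn ℂ f K)
    (hfi : ∀ z ∈ K, 0 ≤ z.im → X.integrand z = f z) :
    ∃ Q : ℂ → ℂ, ∀ z ∈ K, HasDerivAt Q (f z) z ∧ (0 ≤ z.im → X.develop z = Q z) := by
  obtain ⟨Q, hQ⟩ := hK.exists_primitive hKo hf
  refine ⟨fun z => Q z - Q Complex.I, fun z hz => ⟨(hQ z hz).sub_const _, fun him => ?_⟩⟩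
  have hseg : ∀ s ∈ Set.Icc (0 : ℝ) 1, Complex.I + s * (z - Complex.I) ∈ K := by
    intro s hs
    have := hK.add_smul_sub_mem hI hz hs
    simpa using this
  have himseg : ∀ s ∈ Set.Icc (0 : ℝ) 1, 0 ≤ (Complex.I + s * (z - Complex.I)).im := by
    intro s hs
    simp
    nlinarith [hs.1, hs.2, mul_nonneg hs.1 him]
  have huIcc : Set.uIcc (0 : ℝ) 1 = Set.Icc 0 1 := Set.uIcc_of_le zero_le_one
  have hline : Continuous fun s : ℝ => Complex.I + s * (z - Complex.I) := by fun_prop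
  have h1 : X.develop z =
      ∫ s in (0 : ℝ)..1, f (Complex.I + s * (z - Complex.I)) * (z - Complex.I) := by
    refine intervalIntegral.integral_congr fun s hs => ?_
    rw [huIcc] at hs
    simp only [hfi _ (hseg s hs) (himseg s hs)]
  rw [h1, intervalIntegral.integral_eq_sub_of_hasDerivAt
    (f := fun s : ℝ => Q (Complex.I + s * (z - Complex.I)))]
  · simp
  · intro s hs
    rw [huIcc] at hs
    have h2 : HasDerivAt (fun s : ℝ => Complex.I + s * (z - Complex.I)) (z - Complex.I) s := by
      have := ((Complex.ofRealCLM.hasDerivAt (x := s)).mul_const (z - Complex.I)).const_add Complex.I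
      simpa using this
    exact (hQ _ (hseg s hs)).comp s h2
  · apply ContinuousOn.intervalIntegrable
    rw [huIcc]
    exact (hf.continuousOn.comp hline.continuousOn hseg).mul continuousOn_const

theorem hasDerivAt_develop (X : Orthodisk P) {z : ℂ} (hz : 0 < z.im) :
    HasDerivAt X.develop (X.scale * (sqrtUpper P.t z * X.ratFactor z)) z := by
  have hne : ∀ w : ℂ, 0 < w.im → ∀ i, w ≠ P.t i := fun w hw i h => by
    rw [h] at hw; simp at hw
  obtain ⟨Q, hQ⟩ := X.exists_primitive_develop (convex_halfSpace_im_gt 0)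
    (isOpen_lt continuous_const Complex.continuous_im) (by simp)
    (f := fun z => X.scale * (sqrtUpper P.t z * X.ratFactor z))
    (fun w hw => (((differentiableAt_sqrtUpper hw).mul
      (X.differentiableAt_ratFactor (hne w hw))).const_mul _).differentiableWithinAt)
    (fun w hw _ => X.integrand_eq (hne w hw))
  refine (hQ z hz).1.congr_of_eventuallyEq ?_
  filter_upwards [(isOpen_lt continuous_const Complex.continuous_im).mem_nhds hz] with w hw
  exact (hQ w hw).2 (le_of_lt hw)

/-- The integration path of `develop` is the segment from `I`, which stays in the convex wedge. On
the wedge `sqrtNear` continues the integrand past the edge, so the primitive `Q` lives on a full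
neighborhood of `x`, while it equals `develop` only on the closed upper side. -/
theorem exists_develop_near (X : Orthodisk P) {x : ℝ} (hx : ∀ i, x ≠ P.t i) :
    ∃ Q : ℂ → ℂ, ∀ᶠ z in 𝓝 (x : ℂ),
      HasDerivAt Q (X.scale * (sqrtNear P.t x z * X.ratFactor z)) z ∧
        (0 ≤ z.im → X.develop z = Q z) := by
  have hsub := P.wedge_subset_slitDomain x
  obtain ⟨Q, hQ⟩ := X.exists_primitive_develop (P.convex_wedge x) (P.isOpen_wedge x)
    (P.I_mem_wedge x) (f := fun z => X.scale * (sqrtNear P.t x z * X.ratFactor z))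
    (fun w hw => ((((differentiableOn_sqrtNear x).differentiableAt
      ((isOpen_slitDomain x).mem_nhds (hsub hw))).mul
      (X.differentiableAt_ratFactor (ne_of_mem_slitDomain (hsub hw)))).const_mul
        _).differentiableWithinAt)
    (fun w hw him => by
      rw [X.integrand_eq (ne_of_mem_slitDomain (hsub hw)), sqrtNear_eq_sqrtUpper (hsub hw) him])
  exact ⟨Q, Filter.eventually_of_mem ((P.isOpen_wedge x).mem_nhds (P.mem_wedge hx)) hQ⟩

/-! ### Directions and periods -/

theorem integrand_ne_zero (X : Orthodisk P) {z : ℂ} (hz : ∀ i, z ≠ P.t i) : X.integrand z ≠ 0 := by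
  rw [X.integrand_eq hz]
  exact mul_ne_zero X.scale_ne (mul_ne_zero (sqrtUpper_ne_zero hz) (X.ratFactor_ne_zero hz))

theorem conj_direction_mul_self (X : Orthodisk P) {p : ℝ} (hp : ∀ i, (p : ℂ) ≠ P.t i) :
    conj (X.direction p) * X.direction p = 1 := by
  have h : ‖X.direction p‖ = 1 := by
    rw [direction, norm_div, Complex.norm_real, norm_norm, div_self]
    exact norm_ne_zero_iff.mpr (X.integrand_ne_zero hp)
  rw [Complex.conj_mul', h]; simp

/-- The map `w ↦ d ^ 2 * conj w` is the reflection in the direction `d` of the edge, and `w` minus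
its reflection is twice the orthogonal component. -/
theorem period_eq (X : Orthodisk P) {p : ℝ} (hp : ∀ i, (p : ℂ) ≠ P.t i) (q : ℝ) :
    2 * X.period p q = (X.develop q - X.develop p) -
      X.direction p ^ 2 * conj (X.develop q - X.develop p) := by
  have h := X.conj_direction_mul_self hp
  rw [period, Complex.re_eq_add_conj]
  simp only [map_mul, Complex.conj_conj]
  linear_combination (-(X.develop q - X.develop p)) * h

/-- At real points `ratFactor` is real, and the square of `sqrtUpper` is the real product `∏ (p - t
i)`. Hence the edges turn by a right angle, up to orientation, at each vertex. -/
theorem direction_sq (X : Orthodisk P) {p : ℝ} (hp : ∀ i, p ≠ P.t i) :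
    X.direction p ^ 2 = realSign P.t p * (X.scale / ‖X.scale‖) ^ 2 := by
  have hpc : ∀ i, (p : ℂ) ≠ P.t i := fun i => by exact_mod_cast hp i
  have hreal : conj (X.ratFactor p) = X.ratFactor p := by
    rw [← ratFactor_conj, Complex.conj_ofReal]
  have hR := X.ratFactor_ne_zero hpc
  have hR2 : (‖X.ratFactor p‖ : ℂ) ^ 2 = X.ratFactor p ^ 2 := by
    rw [← Complex.conj_mul', hreal, sq]
  have hY := sqrtUpper_ne_zero hpc
  have hY2 : sqrtUpper P.t p ^ 2 = realSign P.t p * (‖sqrtUpper P.t p‖ : ℂ) ^ 2 := by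
    rw [← Complex.ofReal_pow, ← norm_pow, sqrtUpper_sq, norm_prod, realSign, ← Complex.ofReal_mul,
      ← Finset.prod_mul_distrib]
    push_cast
    refine Finset.prod_congr rfl fun i _ => ?_
    rw [← Complex.ofReal_sub, Complex.norm_real, Real.norm_eq_abs]
    split_ifs with h
    · rw [abs_of_pos (sub_pos.mpr h)]; simp
    · rw [abs_of_nonpos (sub_nonpos.mpr (not_lt.mp h))]; simp
  have hs : (‖X.scale‖ : ℂ) ≠ 0 := by simpa using X.scale_ne
  have hYn : (‖sqrtUpper P.t p‖ : ℂ) ≠ 0 := by simpa using hY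
  have hRn : (‖X.ratFactor p‖ : ℂ) ≠ 0 := by simpa using hR
  rw [direction, X.integrand_eq hpc, norm_mul, norm_mul]
  push_cast
  simp only [div_pow, mul_pow]
  rw [hY2, ← hR2]
  field_simp

/-- To the right of all vertices every factor of the integrand is positive, so this edge shows the
argument of the scale factor. -/
theorem direction_of_forall_lt (X : Orthodisk P) {p : ℝ} (hp : ∀ i, P.t i < p) :
    X.direction p = X.scale / ‖X.scale‖ := by
  have key : X.integrand p =
      X.scale * ((∏ i, (p - P.t i) ^ ((X.a i : ℝ) / 2) : ℝ) : ℂ) := by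
    rw [integrand, Complex.ofReal_prod]
    congr 1
    refine Finset.prod_congr rfl fun i _ => ?_
    rw [Complex.ofReal_cpow (sub_pos.mpr (hp i)).le]
    push_cast
    rfl
  have hpos : 0 < ∏ i, (p - P.t i) ^ ((X.a i : ℝ) / 2) :=
    Finset.prod_pos fun i _ => Real.rpow_pos_of_pos (sub_pos.mpr (hp i)) _
  have hne : ((∏ i, (p - P.t i) ^ ((X.a i : ℝ) / 2) : ℝ) : ℂ) ≠ 0 := by exact_mod_cast hpos.ne'
  rw [direction, key, norm_mul, Complex.norm_real, Real.norm_of_nonneg hpos.le, Complex.ofReal_mul]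
  exact mul_div_mul_right _ _ hne

end Orthodisk

/-! ### The difference of two conjugate developing maps. -/

namespace Orthodisk

variable {n : ℕ} {P : ConformalPolygon n} {X₁ X₂ : Orthodisk P} {e : ℂ}

/-- The direction, after the rotation by `conj e`, of the last developed edge. -/
noncomputable def lastDirection (e : ℂ) (X : Orthodisk P) : ℂ := conj e * (X.scale / ‖X.scale‖)

theorem conj_mul_scale_left (e : ℂ) (X : Orthodisk P) :
    conj e * X.scale = ‖X.scale‖ * lastDirection e X := by
  have : (‖X.scale‖ : ℂ) ≠ 0 := by simpa using X.scale_ne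
  rw [lastDirection]; field_simp

theorem conj_mul_self_lastDirection (he : ‖e‖ = 1) (X : Orthodisk P) :
    conj (lastDirection e X) * lastDirection e X = 1 := by
  have h : ‖lastDirection e X‖ = 1 := by
    rw [lastDirection, norm_mul, norm_div, Complex.norm_conj, Complex.norm_real, norm_norm, he,
      one_mul, div_self (norm_ne_zero_iff.mpr X.scale_ne)]
  rw [Complex.conj_mul', h]; simp

/-- The conjugacy of directions, read on the last edge. Together with `conj_mul_scale_left` it shows
that the product of the rotated scale factors is positive. -/
theorem ConjugateAlong.conj_mul_scale_right (he : ‖e‖ = 1) (h : ConjugateAlong e X₁ X₂) :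
    conj e * X₂.scale = ‖X₂.scale‖ * conj (lastDirection e X₁) := by
  obtain ⟨p, hp, hpe⟩ := P.exists_mem_last_edge
  have h1 := h.1 _ p hpe
  rw [X₁.direction_of_forall_lt hp, X₂.direction_of_forall_lt hp, reflect] at h1
  have h2 : (‖X₂.scale‖ : ℂ) ≠ 0 := by simpa using X₂.scale_ne
  have h3 : conj e * e = 1 := by rw [Complex.conj_mul', he]; simp
  rw [div_eq_iff h2] at h1
  conv_lhs => rw [h1]
  rw [lastDirection]
  simp only [map_mul, Complex.conj_conj]
  linear_combination (e * conj (X₁.scale / ‖X₁.scale‖) * ‖X₂.scale‖) * h3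

/-- The difference of the rotated developing map of `X₁` and the conjugate of that of `X₂`, in
units of the direction of the last edge. -/
noncomputable def developDiff (e : ℂ) (X₁ X₂ : Orthodisk P) (z : ℂ) : ℂ :=
  conj (lastDirection e X₁) * (conj e * X₁.develop z - conj (conj e * X₂.develop z))

/-- Here `W₁`, `W₂` are displacements, `p₁`, `p₂` their components orthogonal to the edges, and `d`,
`e ^ 2 * conj d` the edge directions. The vectors `conj e * W₁` and `conj (conj e * W₂)` refer to
the same direction `conj e * d`, and by `hper` they have the same orthogonal component. Their
difference `V` is thus fixed by the reflection in that direction, `V = σ * u ^ 2 * conj V`;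
multiplication by `conj u` gives the claim. -/
theorem reflection_algebra {e d u W₁ W₂ p₁ p₂ : ℂ} {σ : ℝ} (hee : conj e * e = 1)
    (hu : conj u * u = 1) (hud : (conj e) ^ 2 * d ^ 2 = σ * u ^ 2)
    (h1 : 2 * p₁ = W₁ - d ^ 2 * conj W₁)
    (h2 : 2 * p₂ = W₂ - (e ^ 2 * conj d) ^ 2 * conj W₂) (hper : p₂ = e ^ 2 * conj p₁) :
    conj u * (conj e * W₁ - conj (conj e * W₂)) =
      σ * conj (conj u * (conj e * W₁ - conj (conj e * W₂))) := by
  have hE : conj W₂ - (conj e ^ 2 * d) ^ 2 * W₂ = conj e ^ 2 * (W₁ - d ^ 2 * conj W₁) := by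
    have h2c := congrArg conj h2
    have hperc := congrArg conj hper
    simp only [map_mul, map_sub, map_pow, Complex.conj_conj, Complex.conj_ofNat] at h2c hperc
    linear_combination -h2c + 2 * hperc + conj e ^ 2 * h1
  have hA : conj u * e * conj e ^ 2 * d ^ 2 = σ * u * e := by
    linear_combination conj u * e * hud + σ * u * e * hu
  have hB : conj u * e * conj e ^ 4 * d ^ 2 = σ * u * conj e := by
    linear_combination conj u * e * conj e ^ 2 * hud + σ * u * e * conj e ^ 2 * hu +
      σ * u * conj e * hee
  simp only [map_mul, map_sub, Complex.conj_conj]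
  linear_combination -(conj u * e) * hE - conj u * conj e * W₁ * hee + conj W₁ * hA - W₂ * hB

/-- The periods are matched exactly when the difference of the developing maps moves, from an edge
to a parallel edge, in the direction of the edges. -/
theorem ConjugateAlong.developDiff_sub (he : ‖e‖ = 1) (h : ConjugateAlong e X₁ X₂) {p q : ℝ}
    (hp : ∀ i, p ≠ P.t i) (hq : ∀ i, q ≠ P.t i) (hpq : realSign P.t p = realSign P.t q) :
    developDiff e X₁ X₂ q - developDiff e X₁ X₂ p =
      realSign P.t p * conj (developDiff e X₁ X₂ q - developDiff e X₁ X₂ p) := by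
  obtain ⟨j, hj, hjs⟩ := P.exists_mem_edge hp
  obtain ⟨k, hk, hks⟩ := P.exists_mem_edge hq
  have hjk : (j : ℕ) % 2 = (k : ℕ) % 2 := by
    rw [hjs, hks] at hpq
    have hj' := j.2
    have hk' := k.2
    rcases Nat.even_or_odd (n - j) with h1 | h1 <;> rcases Nat.even_or_odd (n - k) with h2 | h2 <;>
      rw [h1.neg_one_pow, h2.neg_one_pow] at hpq <;> try norm_num at hpq
    · rw [Nat.even_iff] at h1 h2; omega
    · rw [Nat.odd_iff] at h1 h2; omega
  have hpc : ∀ i, (p : ℂ) ≠ P.t i := fun i => by exact_mod_cast hp i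
  have hee : conj e * e = 1 := by rw [Complex.conj_mul', he]; simp
  have h1 := X₁.period_eq hpc q
  have h2 := X₂.period_eq hpc q
  rw [h.1 j p hj, reflect] at h2
  have hud : (conj e) ^ 2 * X₁.direction p ^ 2 = realSign P.t p * lastDirection e X₁ ^ 2 := by
    rw [X₁.direction_sq hp, lastDirection]; ring
  have key := reflection_algebra hee (conj_mul_self_lastDirection he X₁) hud h1 h2
    (h.2 j k hjk p hj q hk)
  have hD : developDiff e X₁ X₂ q - developDiff e X₁ X₂ p =
      conj (lastDirection e X₁) * (conj e * (X₁.develop q - X₁.develop p) -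
        conj (conj e * (X₂.develop q - X₂.develop p))) := by
    simp only [developDiff, map_mul, map_sub, Complex.conj_conj]
    ring
  rw [hD]
  exact key

/-- On the edges of sign `1` the imaginary part of `developDiff` is one constant, and on those of
sign `-1` the real part is; these are the imaginary and the real part of `O`. The two conditions
concern different coordinates, so a single `O` serves for both families. -/
theorem exists_normalized_developDiff (he : ‖e‖ = 1) (h : ConjugateAlong e X₁ X₂) :
    ∃ O : ℂ, ∀ x : ℝ, (∀ i, x ≠ P.t i) →
      developDiff e X₁ X₂ x - O = realSign P.t x * conj (developDiff e X₁ X₂ x - O) := by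
  have hpos : ∃ b : ℝ, ∀ x : ℝ, (∀ i, x ≠ P.t i) → realSign P.t x = 1 →
      (developDiff e X₁ X₂ x).im = b := by
    by_cases hex : ∃ p : ℝ, (∀ i, p ≠ P.t i) ∧ realSign P.t p = 1
    · obtain ⟨p, hp, hps⟩ := hex
      refine ⟨(developDiff e X₁ X₂ p).im, fun x hx hxs => ?_⟩
      have h1 := congrArg Complex.im (h.developDiff_sub he hp hx (by rw [hps, hxs]))
      rw [hps] at h1
      simp at h1
      linarith
    · exact ⟨0, fun x hx hxs => absurd ⟨x, hx, hxs⟩ hex⟩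
  have hneg : ∃ a : ℝ, ∀ x : ℝ, (∀ i, x ≠ P.t i) → realSign P.t x = -1 →
      (developDiff e X₁ X₂ x).re = a := by
    by_cases hex : ∃ p : ℝ, (∀ i, p ≠ P.t i) ∧ realSign P.t p = -1
    · obtain ⟨p, hp, hps⟩ := hex
      refine ⟨(developDiff e X₁ X₂ p).re, fun x hx hxs => ?_⟩
      have h1 := congrArg Complex.re (h.developDiff_sub he hp hx (by rw [hps, hxs]))
      rw [hps] at h1
      simp at h1
      linarith
    · exact ⟨0, fun x hx hxs => absurd ⟨x, hx, hxs⟩ hex⟩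
  obtain ⟨b, hb⟩ := hpos
  obtain ⟨a, ha⟩ := hneg
  refine ⟨⟨a, b⟩, fun x hx => ?_⟩
  rcases sq_eq_one_iff.mp (realSign_sq (t := P.t) x) with hs | hs
  · rw [hs]
    apply Complex.ext <;> simp [hb x hx hs]
  · rw [hs]
    apply Complex.ext
    · simp [ha x hx hs]
    · simp; ring

/-- The form `c ω₁ - conj (c ω₂)`, for the canonical forms `ω₁` and `ω₂` of conjugate orthodisks
and `c = conj e`, is exact on the double cover. -/
theorem ConjugateAlong.exists_potential (he : ‖e‖ = 1) (h : ConjugateAlong e X₁ X₂) :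
    ∃ Ψ : ℂ → ℂ → ℂ, (∀ z y, Ψ z (-y) = -Ψ z y) ∧
      ∀ z y, y ^ 2 = ∏ i, (z - (P.t i : ℂ)) → y ≠ 0 → ∃ Y : ℂ → ℂ, ContinuousAt Y z ∧ Y z = y ∧
        (∀ᶠ w in 𝓝 z, Y w ^ 2 = ∏ i, (w - (P.t i : ℂ))) ∧
        HasFDerivAt (fun w => Ψ w (Y w)) (pairForm (conj e * (X₁.scale * y * X₁.ratFactor z))
          (conj e * (X₂.scale * y * X₂.ratFactor z))) z := by
  set u := lastDirection e X₁ with hu_def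
  have hu : conj u * u = 1 := conj_mul_self_lastDirection he X₁
  have hs₁ : conj e * X₁.scale = ‖X₁.scale‖ * u := conj_mul_scale_left e X₁
  have hs₂ : conj e * X₂.scale = ‖X₂.scale‖ * conj u := h.conj_mul_scale_right he
  obtain ⟨O, hO⟩ := exists_normalized_developDiff he h
  -- Division by `u` turns both rotated scale factors into their absolute values. The coefficients
  -- then commute with conjugation, as the reflection principle requires; the factor `u` is restored
  -- at the end.
  have hform : ∀ {D₁ D₂ : ℂ → ℂ} {Y z : ℂ},
      HasDerivAt D₁ (X₁.scale * (Y * X₁.ratFactor z)) z →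
      HasDerivAt D₂ (X₂.scale * (Y * X₂.ratFactor z)) z →
      HasFDerivAt (fun w => conj u * (conj e * D₁ w - conj (conj e * D₂ w)) - O)
        (pairForm (Y * (‖X₁.scale‖ * X₁.ratFactor z)) (Y * (‖X₂.scale‖ * X₂.ratFactor z))) z := by
    intro D₁ D₂ Y z h1 h2
    have h3 := (((h1.const_mul (conj e)).hasFDerivAt_pairForm (h2.const_mul (conj e))).const_mul
      (conj u)).sub_const O
    refine h3.congr_fderiv ?_
    ext v
    have e1 : conj u * (conj e * X₁.scale) = ‖X₁.scale‖ := by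
      rw [hs₁]; linear_combination (‖X₁.scale‖ : ℂ) * hu
    have e2 : conj u * conj (conj e * X₂.scale) = ‖X₂.scale‖ := by
      rw [hs₂, map_mul, Complex.conj_conj, Complex.conj_ofReal]
      linear_combination (‖X₂.scale‖ : ℂ) * hu
    simp only [map_mul, Complex.conj_conj] at e2
    simp only [smul_apply, pairForm_apply, smul_eq_mul, map_mul,
      Complex.conj_ofReal, Complex.conj_conj]
    linear_combination Y * X₁.ratFactor z * v * e1 -
      conj Y * conj (X₂.ratFactor z) * conj v * e2
  obtain ⟨E, hodd, hE⟩ := exists_double_cover_extension (t := P.t)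
    (r₁ := fun z => ‖X₁.scale‖ * X₁.ratFactor z) (r₂ := fun z => ‖X₂.scale‖ * X₂.ratFactor z)
    (E₀ := fun z => developDiff e X₁ X₂ z - O)
    (fun z => by simp [ratFactor_conj]) (fun z => by simp [ratFactor_conj])
    (fun z hz => hform (X₁.hasDerivAt_develop hz) (X₂.hasDerivAt_develop hz))
    (fun x hx => by
      refine ⟨hO x hx, ?_⟩
      obtain ⟨Q₁, hQ₁⟩ := X₁.exists_develop_near hx
      obtain ⟨Q₂, hQ₂⟩ := X₂.exists_develop_near hx
      refine ⟨fun w => conj u * (conj e * Q₁ w - conj (conj e * Q₂ w)) - O, ?_⟩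
      filter_upwards [hQ₁, hQ₂] with z h1 h2
      refine ⟨hform h1.1 h2.1, fun him => ?_⟩
      simp only [developDiff, h1.2 him, h2.2 him, ← hu_def])
  refine ⟨fun z y => u * E z y, fun z y => by simp [hodd], fun z y hy hy0 => ?_⟩
  obtain ⟨Y, hYc, hYz, hYs, hYd⟩ := hE z y hy hy0
  refine ⟨Y, hYc, hYz, hYs, (hYd.const_mul u).congr_fderiv ?_⟩
  ext v
  have hs₂c := congrArg conj hs₂
  simp only [map_mul, Complex.conj_conj, Complex.conj_ofReal] at hs₂c
  simp only [smul_apply, pairForm_apply, smul_eq_mul, map_mul,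
    Complex.conj_ofReal, Complex.conj_conj]
  linear_combination -(y * X₁.ratFactor z * v) * hs₁ +
    conj y * conj (X₂.ratFactor z) * conj v * hs₂c

end Orthodisk

/-! ### Local coordinates at a branch point. -/

open Filter in
theorem AnalyticAt.exists_injOn_of_deriv_ne_zero {f : ℂ → ℂ} {s₀ : ℂ} (hf : AnalyticAt ℂ f s₀)
    (hd : deriv f s₀ ≠ 0) : ∃ N ∈ 𝓝 s₀, Set.InjOn f N := by
  have h := (hf.hasStrictDerivAt.hasStrictFDerivAt_equiv hd).eventually_left_inverse
  refine ⟨_, h, fun s hs s' hs' heq => ?_⟩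
  rw [← hs.out, ← hs'.out, heq]

open Filter in
/-- The local involution `s ↦ -s` in the coordinate `w`. -/
theorem AnalyticAt.exists_local_involution {w : ℂ → ℂ} {s₀ : ℂ} (hw : AnalyticAt ℂ w s₀)
    (hw0 : w s₀ = 0) (hd : deriv w s₀ ≠ 0) :
    ∃ ι : ℂ → ℂ, Tendsto ι (𝓝[≠] s₀) (𝓝[≠] s₀) ∧ ∀ᶠ s in 𝓝 s₀, w (ι s) = -w s := by
  have hs := hw.hasStrictDerivAt.hasStrictFDerivAt_equiv hd
  set g := hs.localInverse w _ s₀ with hg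
  have hright : ∀ᶠ y in 𝓝 (w s₀), w (g y) = y := hs.eventually_right_inverse
  have hgt : Tendsto g (𝓝 (w s₀)) (𝓝 s₀) := by
    have := hs.localInverse_continuousAt.tendsto
    rwa [← hg, show g (w s₀) = s₀ from hs.localInverse_apply_image] at this
  have hneg : Tendsto (fun s => -w s) (𝓝 s₀) (𝓝 (w s₀)) := by
    have := hw.continuousAt.tendsto.neg
    simpa [hw0] using this
  have hev : ∀ᶠ s in 𝓝 s₀, w (g (-w s)) = -w s := hneg.eventually hright
  refine ⟨fun s => g (-w s), ?_, hev⟩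
  refine tendsto_nhdsWithin_iff.mpr ⟨(hgt.comp hneg).mono_left nhdsWithin_le_nhds, ?_⟩
  have hne : ∀ᶠ s in 𝓝[≠] s₀, w s ≠ 0 := by
    obtain ⟨N, hN, hinj⟩ := hw.exists_injOn_of_deriv_ne_zero hd
    filter_upwards [self_mem_nhdsWithin, mem_nhdsWithin_of_mem_nhds hN] with s h1 h2 h3
    exact h1 (hinj h2 (mem_of_mem_nhds hN) (by rw [h3, hw0]))
  filter_upwards [hne, hev.filter_mono nhdsWithin_le_nhds] with s h1 h2 h3
  rw [Set.mem_singleton_iff.mp h3, hw0] at h2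
  exact h1 (neg_eq_zero.mp h2.symm)

theorem AnalyticAt.meromorphicOrderAt_of_ne_zero {f : ℂ → ℂ} {s₀ : ℂ} (hf : AnalyticAt ℂ f s₀)
    (h0 : f s₀ ≠ 0) : meromorphicOrderAt f s₀ = 0 := by
  rw [hf.meromorphicOrderAt_eq, hf.analyticOrderAt_eq_zero.mpr h0]; rfl

theorem AnalyticAt.meromorphicOrderAt_of_deriv_ne_zero {f : ℂ → ℂ} {s₀ : ℂ}
    (hf : AnalyticAt ℂ f s₀) (h0 : f s₀ = 0) (hd : deriv f s₀ ≠ 0) :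
    meromorphicOrderAt f s₀ = 1 := by
  have := hf.analyticOrderAt_sub_eq_one_of_deriv_ne_zero hd
  simp only [h0, sub_zero] at this
  rw [hf.meromorphicOrderAt_eq, this]; rfl

open Filter in
/-- A pair `(v, w)` of local functions that satisfies the equation `w ^ 2 = v ψ(v)` of a simple
branch point, and separates points. -/
theorem branch_point_orders {v w ψ : ℂ → ℂ} {s₀ : ℂ} (hv : AnalyticAt ℂ v s₀)
    (hw : AnalyticAt ℂ w s₀) (hv0 : v s₀ = 0) (hw0 : w s₀ = 0) (hψ : AnalyticAt ℂ ψ 0)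
    (hψ0 : ψ 0 ≠ 0) (heq : ∀ᶠ s in 𝓝 s₀, w s ^ 2 = v s * ψ (v s)) {V : Set ℂ} (hV : V ∈ 𝓝 s₀)
    (hinj : ∀ s ∈ V, ∀ s' ∈ V, v s = v s' → w s = w s' → s = s') :
    meromorphicOrderAt w s₀ = 1 ∧ meromorphicOrderAt v s₀ = 2 ∧
      ∃ ι : ℂ → ℂ, Tendsto ι (𝓝[≠] s₀) (𝓝[≠] s₀) ∧
        ∀ᶠ s in 𝓝 s₀, s ≠ s₀ → v (ι s) = v s ∧ w (ι s) = -w s := by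
  -- The function `u * ψ u` has a simple zero at `0`, so `w ^ 2` determines `v` locally. Hence `w`
  -- alone separates points and is a local coordinate, and changing its sign fixes `v`.
  have hφ : AnalyticAt ℂ (fun u => u * ψ u) 0 := analyticAt_id.mul hψ
  have hφd : deriv (fun u => u * ψ u) 0 ≠ 0 := by
    have h := (hasDerivAt_id (0 : ℂ)).mul hψ.differentiableAt.hasDerivAt
    have h2 : HasDerivAt (fun u => u * ψ u) (ψ 0) 0 := by simpa using! h
    rwa [h2.deriv]
  obtain ⟨N, hN, hNinj⟩ := hφ.exists_injOn_of_deriv_ne_zero hφd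
  have hvN : ∀ᶠ s in 𝓝 s₀, v s ∈ N :=
    hv.continuousAt.eventually (by rw [hv0]; exact hN)
  have hW : {s | s ∈ V ∧ v s ∈ N ∧ w s ^ 2 = v s * ψ (v s)} ∈ 𝓝 s₀ := by
    filter_upwards [hV, hvN, heq] with s h1 h2 h3 using ⟨h1, h2, h3⟩
  have hwd : deriv w s₀ ≠ 0 := by
    refine hw.deriv_ne_zero_of_injOn hW ?_
    rintro s ⟨h1, h2, h3⟩ s' ⟨h1', h2', h3'⟩ hss
    refine hinj s h1 s' h1' (hNinj h2 h2' ?_) hss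
    simp only [← h3, ← h3', hss]
  have hw1 := hw.meromorphicOrderAt_of_deriv_ne_zero hw0 hwd
  refine ⟨hw1, ?_, ?_⟩
  · have h1 : meromorphicOrderAt (w ^ 2) s₀ = 2 := by
      rw [meromorphicOrderAt_pow hw.meromorphicAt, hw1]; rfl
    have hψv : AnalyticAt ℂ (ψ ∘ v) s₀ := AnalyticAt.comp (by rwa [hv0]) hv
    have h2 : meromorphicOrderAt (v * (ψ ∘ v)) s₀ = meromorphicOrderAt v s₀ := by
      rw [meromorphicOrderAt_mul hv.meromorphicAt hψv.meromorphicAt,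
        hψv.meromorphicOrderAt_of_ne_zero (by simpa [hv0] using hψ0), add_zero]
    rw [← h2, ← h1]
    refine (meromorphicOrderAt_congr ?_).symm
    exact (heq.filter_mono nhdsWithin_le_nhds)
  · obtain ⟨ι, hι, hιw⟩ := hw.exists_local_involution hw0 hwd
    refine ⟨ι, hι, ?_⟩
    have h1 : ∀ᶠ s in 𝓝[≠] s₀, v (ι s) ∈ N ∧ w (ι s) ^ 2 = v (ι s) * ψ (v (ι s)) :=
      (hι.mono_right nhdsWithin_le_nhds).eventually (hvN.and heq)
    filter_upwards [eventually_nhdsWithin_iff.mp h1, hιw, hvN, heq] with s h1 h2 h3 h4 hne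
    refine ⟨hNinj (h1 hne).1 h3 ?_, h2⟩
    simp only
    rw [← (h1 hne).2, ← h4, h2, neg_sq]

/-! ### Local charts of the hyperelliptic surface. -/

namespace ConformalPolygon

variable {n : ℕ} {P : ConformalPolygon n}

theorem yc_sq {p : P.Z} (hp : p ≠ OnePoint.infty) : P.yc p ^ 2 = ∏ i, (P.zc p - (P.t i : ℂ)) := by
  obtain ⟨q, rfl⟩ := OnePoint.ne_infty_iff_exists.mp hp
  exact q.2

theorem ext_coordinates {p q : P.Z} (hp : p ≠ OnePoint.infty) (hq : q ≠ OnePoint.infty)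
    (hz : P.zc p = P.zc q) (hy : P.yc p = P.yc q) : p = q := by
  obtain ⟨p, rfl⟩ := OnePoint.ne_infty_iff_exists.mp hp
  obtain ⟨q, rfl⟩ := OnePoint.ne_infty_iff_exists.mp hq
  exact congrArg _ (Subtype.ext (Prod.ext hz hy))

@[simp] theorem zc_infty : P.zc OnePoint.infty = 0 := rfl

@[simp] theorem yc_infty : P.yc OnePoint.infty = 0 := rfl

theorem zc_ne_of_ordinary {p : P.Z} (hp : p ∈ P.ordinary) (i : Fin n) : P.zc p ≠ P.t i := by
  intro h
  apply hp.2
  rw [← sq_eq_zero_iff, yc_sq hp.1]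
  exact Finset.prod_eq_zero (Finset.mem_univ i) (by rw [h, sub_self])

theorem exists_vertex_of_yc_eq_zero {p : P.Z} (hp : p ≠ OnePoint.infty) (hy : P.yc p = 0) :
    ∃ i, P.zc p = P.t i := by
  have h := yc_sq hp
  rw [hy, zero_pow two_ne_zero, eq_comm, Finset.prod_eq_zero_iff] at h
  obtain ⟨i, -, hi⟩ := h
  exact ⟨i, sub_eq_zero.mp hi⟩

open Filter in
/-- The projection `z` is proper. -/
theorem tendsto_zc_infty : Tendsto P.zc (𝓝[≠] OnePoint.infty) (Bornology.cobounded ℂ) := by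
  rw [OnePoint.nhdsNE_infty_eq, tendsto_map'_iff, Metric.cobounded_eq_cocompact,
    coclosedCompact_eq_cocompact]
  rw [(hasBasis_cocompact.tendsto_iff hasBasis_cocompact)]
  intro K hK
  have hcont : Continuous fun z : ℂ => ∏ i, (z - (P.t i : ℂ)) := by fun_prop
  -- Over a compact set of `z` the equation bounds `‖y‖ ^ 2` by `M`, hence `‖y‖` by `M + 1`.
  obtain ⟨M, hM⟩ := (hK.image hcont).isBounded.exists_norm_le
  refine ⟨(fun q : P.AffineCurve => q.1) ⁻¹' (K ×ˢ Metric.closedBall 0 (M + 1)), ?_, ?_⟩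
  · have hcl : IsClosed {p : ℂ × ℂ | p.2 ^ 2 = ∏ i, (p.1 - (P.t i : ℂ))} :=
      isClosed_eq (by fun_prop) (by fun_prop)
    exact hcl.isClosedEmbedding_subtypeVal.isCompact_preimage
      (hK.prod (isCompact_closedBall _ _))
  · intro q hq hqK
    apply hq
    refine ⟨hqK, ?_⟩
    have h1 := hM _ ⟨_, hqK, rfl⟩
    have h2 : ‖q.1.2‖ ^ 2 ≤ M := by
      rw [← norm_pow, q.2]; exact h1
    rw [mem_closedBall_zero_iff]
    nlinarith [sq_nonneg (‖q.1.2‖ - 1), norm_nonneg q.1.2]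

namespace IsLocalChart

variable {U : Set ℂ} {σ : ℂ → P.Z}

theorem isOpen_finite (hσ : P.IsLocalChart U σ) : IsOpen {s ∈ U | σ s ≠ OnePoint.infty} :=
  hσ.2.1.isOpen_inter_preimage hσ.1 OnePoint.isClosed_infty.isOpen_compl

theorem analyticAt_zc (hσ : P.IsLocalChart U σ) {s : ℂ} (hs : s ∈ U) (hsf : σ s ≠ OnePoint.infty) :
    AnalyticAt ℂ (fun s => P.zc (σ s)) s :=
  hσ.2.2.2.1.analyticAt (hσ.isOpen_finite.mem_nhds ⟨hs, hsf⟩)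

theorem analyticAt_yc (hσ : P.IsLocalChart U σ) {s : ℂ} (hs : s ∈ U) (hsf : σ s ≠ OnePoint.infty) :
    AnalyticAt ℂ (fun s => P.yc (σ s)) s :=
  hσ.2.2.2.2.analyticAt (hσ.isOpen_finite.mem_nhds ⟨hs, hsf⟩)

theorem eventually_finite (hσ : P.IsLocalChart U σ) {s₀ : ℂ} (hs : s₀ ∈ U) :
    ∀ᶠ s in 𝓝[≠] s₀, s ∈ U ∧ σ s ≠ OnePoint.infty := by
  by_cases h : σ s₀ = OnePoint.infty
  · filter_upwards [self_mem_nhdsWithin, mem_nhdsWithin_of_mem_nhds (hσ.1.mem_nhds hs)] with s h1 h2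
    refine ⟨h2, fun h3 => h1 (hσ.2.2.1 h2 hs (by rw [h3, h]))⟩
  · exact mem_nhdsWithin_of_mem_nhds (hσ.isOpen_finite.mem_nhds ⟨hs, h⟩)

open Filter in
theorem tendsto_zc_cobounded (hσ : P.IsLocalChart U σ) {s₀ : ℂ} (hs : s₀ ∈ U) (hinf : σ s₀ = OnePoint.infty) :
    Tendsto (fun s => P.zc (σ s)) (𝓝[≠] s₀) (Bornology.cobounded ℂ) := by
  refine tendsto_zc_infty.comp (tendsto_nhdsWithin_iff.mpr ⟨?_, ?_⟩)
  · rw [← hinf]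
    exact (hσ.2.1.continuousAt (hσ.1.mem_nhds hs)).tendsto.mono_left nhdsWithin_le_nhds
  · filter_upwards [hσ.eventually_finite hs] with s h using h.2

/-- A removable singularity. The conventions `zc ∞ = 0` and `0⁻¹ = 0` give the inverse its limit `0`
at `s₀`. -/
theorem analyticAt_inv_zc (hσ : P.IsLocalChart U σ) {s₀ : ℂ} (hs : s₀ ∈ U) (hinf : σ s₀ = OnePoint.infty) :
    AnalyticAt ℂ (fun s => (P.zc (σ s))⁻¹) s₀ := by
  refine Complex.analyticAt_of_differentiable_on_punctured_nhds_of_continuousAt ?_ ?_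
  · filter_upwards [hσ.eventually_finite hs,
      (hσ.tendsto_zc_cobounded hs hinf).eventually (Bornology.eventually_ne_cobounded 0)]
      with s h1 h2
    exact (hσ.analyticAt_zc h1.1 h1.2).differentiableAt.inv h2
  · rw [continuousAt_iff_punctured_nhds, hinf, zc_infty, inv_zero]
    exact Filter.tendsto_inv₀_cobounded.comp (hσ.tendsto_zc_cobounded hs hinf)

end IsLocalChart

end ConformalPolygon

theorem meromorphicOrderAt_prod_zpow {ι : Type*} [Fintype ι] {f : ι → ℂ → ℂ} {o : ι → ℤ} {x : ℂ}
    (hf : ∀ i, MeromorphicAt (f i) x) (ho : ∀ i, meromorphicOrderAt (f i) x = o i) (m : ι → ℤ) :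
    meromorphicOrderAt (fun s => ∏ i, f i s ^ m i) x = ((∑ i, m i * o i : ℤ) : WithTop ℤ) := by
  rw [meromorphicOrderAt_fun_prod (f := fun i s => f i s ^ m i) fun i _ => (hf i).zpow (m i)]
  rw [show ((∑ i, m i * o i : ℤ) : WithTop ℤ) = ∑ i, ((m i * o i : ℤ) : WithTop ℤ) from
    map_sum (⟨⟨((↑) : ℤ → WithTop ℤ), rfl⟩, fun _ _ => rfl⟩ : ℤ →+ WithTop ℤ) _ _]
  refine Finset.sum_congr rfl fun i _ => ?_
  have := meromorphicOrderAt_zpow (hf i) (n := m i)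
  rw [ho i] at this
  rw [show (fun s => f i s ^ m i) = f i ^ m i from rfl, this]
  rfl

namespace ConformalPolygon

variable {n : ℕ} {P : ConformalPolygon n}

namespace IsLocalChart

variable {U : Set ℂ} {σ : ℂ → P.Z} {s₀ : ℂ}

open Filter in
theorem tendsto_yc_cobounded (hσ : P.IsLocalChart U σ) (hs : s₀ ∈ U) (hinf : σ s₀ = OnePoint.infty) :
    Tendsto (fun s => P.yc (σ s)) (𝓝[≠] s₀) (Bornology.cobounded ℂ) := by
  have hn := P.three_le
  have h1 := (tendsto_norm_atTop_iff_cobounded.mpr (hσ.tendsto_zc_cobounded hs hinf))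
  set p : Polynomial ℂ := ∏ i, (Polynomial.X - Polynomial.C (P.t i : ℂ)) with hp
  have hdeg : 0 < p.degree := by
    rw [hp, Polynomial.degree_prod]
    simp; omega
  have h2 := p.tendsto_norm_atTop hdeg h1
  rw [← tendsto_norm_atTop_iff_cobounded]
  have h3 : Tendsto (fun s => ‖P.yc (σ s)‖ ^ 2) (𝓝[≠] s₀) atTop := by
    refine h2.congr' ?_
    filter_upwards [hσ.eventually_finite hs] with s h
    rw [← norm_pow, yc_sq h.2, hp, Polynomial.eval_prod]
    simp
  have h4 := Real.tendsto_sqrt_atTop.comp h3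
  refine h4.congr fun s => ?_
  simp [Real.sqrt_sq]

theorem meromorphicAt_zc (hσ : P.IsLocalChart U σ) (hs : s₀ ∈ U) :
    MeromorphicAt (fun s => P.zc (σ s)) s₀ := by
  by_cases hinf : σ s₀ = OnePoint.infty
  · have := (hσ.analyticAt_inv_zc hs hinf).meromorphicAt.inv
    rwa [show (fun s => (P.zc (σ s))⁻¹)⁻¹ = fun s => P.zc (σ s) by ext; simp] at this
  · exact (hσ.analyticAt_zc hs hinf).meromorphicAt

theorem meromorphicAt_yc (hσ : P.IsLocalChart U σ) (hs : s₀ ∈ U) :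
    MeromorphicAt (fun s => P.yc (σ s)) s₀ := by
  by_cases hinf : σ s₀ = OnePoint.infty
  · have h : AnalyticAt ℂ (fun s => (P.yc (σ s))⁻¹) s₀ := by
      refine Complex.analyticAt_of_differentiable_on_punctured_nhds_of_continuousAt ?_ ?_
      · filter_upwards [hσ.eventually_finite hs,
          (hσ.tendsto_yc_cobounded hs hinf).eventually (Bornology.eventually_ne_cobounded 0)]
          with s h1 h2
        exact (hσ.analyticAt_yc h1.1 h1.2).differentiableAt.inv h2
      · rw [continuousAt_iff_punctured_nhds, hinf, yc_infty, inv_zero]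
        exact Filter.tendsto_inv₀_cobounded.comp (hσ.tendsto_yc_cobounded hs hinf)
    have := h.meromorphicAt.inv
    rwa [show (fun s => (P.yc (σ s))⁻¹)⁻¹ = fun s => P.yc (σ s) by ext; simp] at this
  · exact (hσ.analyticAt_yc hs hinf).meromorphicAt

theorem eventually_ordinary (hσ : P.IsLocalChart U σ) (hs : s₀ ∈ U) (hord : σ s₀ ∈ P.ordinary) :
    ∀ᶠ s in 𝓝 s₀, s ∈ U ∧ σ s ∈ P.ordinary := by
  filter_upwards [hσ.isOpen_finite.mem_nhds ⟨hs, hord.1⟩,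
    (hσ.analyticAt_yc hs hord.1).continuousAt.eventually_ne hord.2] with s h1 h2
  exact ⟨h1.1, h1.2, h2⟩

theorem deriv_zc_ne_zero (hσ : P.IsLocalChart U σ) (hs : s₀ ∈ U) (hord : σ s₀ ∈ P.ordinary) :
    deriv (fun s => P.zc (σ s)) s₀ ≠ 0 := by
  have hy := (hσ.analyticAt_yc hs hord.1).continuousAt
  -- Two opposite values of `y` cannot both lie within `‖y(s₀)‖` of `y(s₀)`. So on this set `z`
  -- determines the point, and injectivity forces a nonzero derivative.
  have hV : {s | (s ∈ U ∧ σ s ∈ P.ordinary) ∧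
      ‖P.yc (σ s) - P.yc (σ s₀)‖ < ‖P.yc (σ s₀)‖} ∈ 𝓝 s₀ := by
    refine (hσ.eventually_ordinary hs hord).and ?_
    have := Metric.tendsto_nhds.mp hy.tendsto _ (norm_pos_iff.mpr hord.2)
    simpa [dist_eq_norm] using this
  refine (hσ.analyticAt_zc hs hord.1).deriv_ne_zero_of_injOn hV ?_
  rintro s ⟨⟨h1, h2⟩, h3⟩ s' ⟨⟨h1', h2'⟩, h3'⟩ hz
  simp only at hz
  have hsq : P.yc (σ s) ^ 2 = P.yc (σ s') ^ 2 := by rw [yc_sq h2.1, yc_sq h2'.1, hz]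
  rcases sq_eq_sq_iff_eq_or_eq_neg.mp hsq with h | h
  · exact hσ.2.2.1 h1 h1' (ext_coordinates h2.1 h2'.1 hz h)
  · exfalso
    have h4 : (P.yc (σ s) - P.yc (σ s₀)) + (P.yc (σ s') - P.yc (σ s₀)) =
        -(2 * P.yc (σ s₀)) := by rw [h]; ring
    have h5 := norm_add_le (P.yc (σ s) - P.yc (σ s₀)) (P.yc (σ s') - P.yc (σ s₀))
    rw [h4, norm_neg, norm_mul, Complex.norm_ofNat] at h5
    linarith

theorem orders_ordinary (hσ : P.IsLocalChart U σ) (hs : s₀ ∈ U) (hord : σ s₀ ∈ P.ordinary) :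
    meromorphicOrderAt (fun s => P.yc (σ s)) s₀ = 0 ∧
      (∀ i, meromorphicOrderAt (fun s => P.zc (σ s) - P.t i) s₀ = 0) ∧
      meromorphicOrderAt (deriv fun s => P.zc (σ s)) s₀ = 0 :=
  ⟨(hσ.analyticAt_yc hs hord.1).meromorphicOrderAt_of_ne_zero hord.2,
    fun i => ((hσ.analyticAt_zc hs hord.1).sub analyticAt_const).meromorphicOrderAt_of_ne_zero
      (sub_ne_zero.mpr (zc_ne_of_ordinary hord i)),
    (hσ.analyticAt_zc hs hord.1).deriv.meromorphicOrderAt_of_ne_zero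
      (hσ.deriv_zc_ne_zero hs hord)⟩

open Filter in
-- The curve equation is that of a simple branch point for `v = z - t i` and `w = y`, because the
-- other factors do not vanish at `t i`. The map `ι` is the hyperelliptic involution in the chart.
theorem orders_finite_vertex (hσ : P.IsLocalChart U σ) (hs : s₀ ∈ U)
    (hfin : σ s₀ ≠ OnePoint.infty) {i : Fin n} (hi : P.zc (σ s₀) = P.t i) :
    meromorphicOrderAt (fun s => P.yc (σ s)) s₀ = 1 ∧
      (∀ j, meromorphicOrderAt (fun s => P.zc (σ s) - P.t j) s₀ = if j = i then 2 else 0) ∧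
      meromorphicOrderAt (deriv fun s => P.zc (σ s)) s₀ = 1 ∧
      ∃ ι : ℂ → ℂ, Tendsto ι (𝓝[≠] s₀) (𝓝[≠] s₀) ∧ ∀ᶠ s in 𝓝[≠] s₀,
        P.zc (σ (ι s)) = P.zc (σ s) ∧ P.yc (σ (ι s)) = -P.yc (σ s) := by
  classical
  have hz := hσ.analyticAt_zc hs hfin
  have hw := hσ.analyticAt_yc hs hfin
  have hv : AnalyticAt ℂ (fun s => P.zc (σ s) - P.t i) s₀ := hz.sub analyticAt_const
  have hprod : ∀ z : ℂ, ∏ j, (z - (P.t j : ℂ)) =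
      (z - P.t i) * ∏ j ∈ Finset.univ.erase i, ((z - P.t i) + ((P.t i : ℂ) - P.t j)) := by
    intro z
    rw [← Finset.mul_prod_erase _ _ (Finset.mem_univ i)]
    congr 1
    exact Finset.prod_congr rfl fun j _ => by ring
  have hw0 : P.yc (σ s₀) = 0 := by
    rw [← sq_eq_zero_iff, yc_sq hfin, hprod, hi, sub_self, zero_mul]
  obtain ⟨h1, h2, ι, h3, h4⟩ := branch_point_orders hv hw (by simp [hi]) hw0
    (ψ := fun v => ∏ j ∈ Finset.univ.erase i, (v + ((P.t i : ℂ) - P.t j)))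
    (Finset.analyticAt_fun_prod _ fun j _ => analyticAt_id.add analyticAt_const)
    (Finset.prod_ne_zero_iff.mpr fun j hj => by
      rw [zero_add, sub_ne_zero]
      exact_mod_cast P.strictMono.injective.ne (Finset.ne_of_mem_erase hj).symm)
    (by
      filter_upwards [hσ.isOpen_finite.mem_nhds ⟨hs, hfin⟩] with s hs
      rw [yc_sq hs.2, hprod])
    (hσ.isOpen_finite.mem_nhds ⟨hs, hfin⟩)
    (fun s hs s' hs' hv hw => hσ.2.2.1 hs.1 hs'.1
      (ext_coordinates hs.2 hs'.2 (sub_left_injective hv) hw))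
  refine ⟨h1, fun j => ?_, ?_, ι, h3, ?_⟩
  · split_ifs with hj
    · rw [hj]; exact h2
    · refine (hz.sub analyticAt_const).meromorphicOrderAt_of_ne_zero ?_
      simp only [Pi.sub_apply]
      rw [hi, sub_ne_zero]
      exact_mod_cast P.strictMono.injective.ne (Ne.symm hj)
  · have := meromorphicOrderAt_deriv_eq_sub_one (n := 2) (by norm_num) h2
    simpa [deriv_sub_const] using! this
  · filter_upwards [h4.filter_mono nhdsWithin_le_nhds, self_mem_nhdsWithin] with s h hne
    exact ⟨sub_left_injective (h hne).1, (h hne).2⟩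

open Filter in
theorem orders_infinity (hσ : P.IsLocalChart U σ) (hs : s₀ ∈ U) (hinf : σ s₀ = OnePoint.infty)
    (hn : Odd n) :
    meromorphicOrderAt (fun s => P.yc (σ s)) s₀ = ((-n : ℤ) : WithTop ℤ) ∧
      (∀ j, meromorphicOrderAt (fun s => P.zc (σ s) - P.t j) s₀ = ((-2 : ℤ) : WithTop ℤ)) ∧
      meromorphicOrderAt (deriv fun s => P.zc (σ s)) s₀ = ((-3 : ℤ) : WithTop ℤ) ∧
      ∃ ι : ℂ → ℂ, Tendsto ι (𝓝[≠] s₀) (𝓝[≠] s₀) ∧ ∀ᶠ s in 𝓝[≠] s₀,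
        P.zc (σ (ι s)) = P.zc (σ s) ∧ P.yc (σ (ι s)) = -P.yc (σ s) := by
  obtain ⟨m, hm⟩ := hn
  have hm0 : m ≠ 0 := by have := P.three_le; omega
  set ζ : ℂ → ℂ := fun s => P.zc (σ s) with hζ
  set η : ℂ → ℂ := fun s => P.yc (σ s) with hη
  have hv : AnalyticAt ℂ (fun s => (ζ s)⁻¹) s₀ := hσ.analyticAt_inv_zc hs hinf
  have hζ0 : ζ s₀ = 0 := by simp [hζ, hinf]
  have hη0 : η s₀ = 0 := by simp [hη, hinf]
  have hgood : ∀ᶠ s in 𝓝[≠] s₀, (s ∈ U ∧ σ s ≠ OnePoint.infty) ∧ ζ s ≠ 0 ∧ η s ≠ 0 ∧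
      ∀ j, ζ s ≠ P.t j :=
    (hσ.eventually_finite hs).and
      (((hσ.tendsto_zc_cobounded hs hinf).eventually (Bornology.eventually_ne_cobounded 0)).and
      (((hσ.tendsto_yc_cobounded hs hinf).eventually (Bornology.eventually_ne_cobounded 0)).and
      (eventually_all.mpr fun j =>
        (hσ.tendsto_zc_cobounded hs hinf).eventually (Bornology.eventually_ne_cobounded _))))
  have hprod : ∀ z : ℂ, z ≠ 0 → ∏ j, (z - (P.t j : ℂ)) = z ^ n * ∏ j, (1 - P.t j * z⁻¹) := by
    intro z hz
    have h1 : z ^ n = ∏ _j : Fin n, z := by simp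
    rw [h1, ← Finset.prod_mul_distrib]
    exact Finset.prod_congr rfl fun j _ => by field_simp
  -- With `n = 2 * m + 1`, the functions `v = z⁻¹` and `w = z ^ m / y` satisfy `w ^ 2 = v / ∏ (1 - t
  -- j * v)`, again a simple branch point. The order `-n` of `y = z ^ m / w` is `-2 * m - 1`.
  set w : ℂ → ℂ := fun s => ζ s ^ m * (η s)⁻¹ with hw_def
  set ψ : ℂ → ℂ := fun v => (∏ j, (1 - (P.t j : ℂ) * v))⁻¹ with hψ_def
  have hψ0 : ψ 0 = 1 := by simp [hψ_def]
  have hψa : AnalyticAt ℂ ψ 0 := by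
    refine AnalyticAt.inv (Finset.analyticAt_fun_prod _ fun j _ =>
      analyticAt_const.sub (analyticAt_const.mul analyticAt_id)) ?_
    simp
  have hw0 : w s₀ = 0 := by simp [hw_def, hζ0, hη0]
  have heq : ∀ᶠ s in 𝓝 s₀, w s ^ 2 = (ζ s)⁻¹ * ψ ((ζ s)⁻¹) := by
    have h := eventually_nhdsWithin_iff.mp hgood
    filter_upwards [h] with s hs
    rcases eq_or_ne s s₀ with rfl | hne
    -- At `s₀` itself both sides are `0` by the values assigned to `zc` and `yc` at infinity.
    · simp [hw0, hζ0]
    · obtain ⟨⟨-, h2⟩, h3, h4, h5⟩ := hs hne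
      have h6 : η s ^ 2 = ∏ j, (ζ s - (P.t j : ℂ)) := yc_sq h2
      have h7 : (∏ j, (1 - (P.t j : ℂ) * (ζ s)⁻¹)) ≠ 0 := by
        have : η s ^ 2 ≠ 0 := pow_ne_zero 2 h4
        rw [h6, hprod _ h3] at this
        exact right_ne_zero_of_mul this
      rw [hprod _ h3] at h6
      simp only [hw_def, hψ_def, mul_pow, inv_pow, h6]
      have h8 : ζ s ^ n = (ζ s ^ m) ^ 2 * ζ s := by rw [hm]; ring
      rw [h8]
      generalize (∏ j, (1 - (P.t j : ℂ) * (ζ s)⁻¹)) = q at h7 ⊢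
      field_simp
  have hwa : AnalyticAt ℂ w s₀ := by
    refine Complex.analyticAt_of_differentiable_on_punctured_nhds_of_continuousAt ?_ ?_
    · filter_upwards [hgood] with s h
      exact ((hσ.analyticAt_zc h.1.1 h.1.2).differentiableAt.pow m).mul
        ((hσ.analyticAt_yc h.1.1 h.1.2).differentiableAt.inv h.2.2.1)
    · have h1 : Tendsto (fun s => (ζ s)⁻¹ * ψ ((ζ s)⁻¹)) (𝓝 s₀) (𝓝 0) := by
        have h2 : AnalyticAt ℂ (fun s => ψ ((ζ s)⁻¹)) s₀ :=
          AnalyticAt.comp (g := ψ) (f := fun s => (ζ s)⁻¹) (by simpa [hζ0] using hψa) hv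
        have h3 := (hv.mul h2).continuousAt.tendsto
        simpa [hζ0] using! h3
      have h2 : Tendsto (fun s => ‖w s‖ ^ 2) (𝓝 s₀) (𝓝 0) := by
        have h3 := (h1.congr' (heq.mono fun _ h => h.symm)).norm
        simpa using h3
      rw [ContinuousAt, hw0, tendsto_zero_iff_norm_tendsto_zero]
      have h3 := (Real.continuous_sqrt.tendsto _).comp h2
      simpa [Function.comp_def, Real.sqrt_sq] using h3
  have hV : {s | s ≠ s₀ → (s ∈ U ∧ σ s ≠ OnePoint.infty) ∧ ζ s ≠ 0 ∧ η s ≠ 0 ∧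
      ∀ j, ζ s ≠ P.t j} ∈ 𝓝 s₀ := eventually_nhdsWithin_iff.mp hgood
  obtain ⟨h1, h2, ι, h3, h4⟩ := branch_point_orders hv hwa (by simp [hζ0]) hw0 hψa
    (by simp [hψ0]) heq hV (fun s hs s' hs' hvv hww => by
      have hzz : ζ s = ζ s' := inv_injective hvv
      rcases eq_or_ne s s₀ with h | hne <;> rcases eq_or_ne s' s₀ with h' | hne'
      · rw [h, h']
      · exact absurd (hzz.symm.trans (h ▸ hζ0)) (hs' hne').2.1
      · exact absurd (hzz.trans (h' ▸ hζ0)) (hs hne).2.1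
      · obtain ⟨⟨h1, h2⟩, h3, h4, h5⟩ := hs hne
        obtain ⟨⟨h1', h2'⟩, h3', h4', h5'⟩ := hs' hne'
        refine hσ.2.2.1 h1 h1' (ext_coordinates h2 h2' hzz ?_)
        simp only [hw_def, hzz] at hww
        exact inv_injective (mul_left_cancel₀ (pow_ne_zero m h3') hww))
  have hζm := hσ.meromorphicAt_zc hs
  have hηm := hσ.meromorphicAt_yc hs
  have hζo : meromorphicOrderAt ζ s₀ = ((-2 : ℤ) : WithTop ℤ) := by
    have : ζ = (fun s => (ζ s)⁻¹)⁻¹ := by ext s; simp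
    rw [this, meromorphicOrderAt_inv, h2]; rfl
  refine ⟨?_, fun j => ?_, ?_, ι, h3, ?_⟩
  · have h5 : η =ᶠ[𝓝[≠] s₀] ζ ^ m * w⁻¹ := by
      filter_upwards [hgood] with s h
      have := h.2.1
      simp only [hw_def, Pi.mul_apply, Pi.pow_apply, Pi.inv_apply, mul_inv, inv_inv]
      field_simp
    rw [meromorphicOrderAt_congr h5, meromorphicOrderAt_mul (hζm.pow m) hwa.meromorphicAt.inv,
      meromorphicOrderAt_pow hζm, meromorphicOrderAt_inv, h1, hζo, hm]
    rw [show -(1 : WithTop ℤ) = ((-1 : ℤ) : WithTop ℤ) from rfl,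
      show (m : WithTop ℤ) = ((m : ℤ) : WithTop ℤ) from rfl, ← WithTop.coe_mul, ← WithTop.coe_add]
    congr 1
    push_cast
    ring
  · have h5 : (fun s => ζ s - P.t j) =ᶠ[𝓝[≠] s₀] ζ * fun s => 1 - P.t j * (ζ s)⁻¹ := by
      filter_upwards [hgood] with s h
      have := h.2.1
      simp only [Pi.mul_apply]
      field_simp
    have h6 : AnalyticAt ℂ (fun s => 1 - P.t j * (ζ s)⁻¹) s₀ :=
      analyticAt_const.sub (analyticAt_const.mul hv)
    rw [meromorphicOrderAt_congr h5, meromorphicOrderAt_mul hζm h6.meromorphicAt,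
      h6.meromorphicOrderAt_of_ne_zero (by simp [hζ0]), add_zero, hζo]
  · exact meromorphicOrderAt_deriv_eq_sub_one (n := -2) (by norm_num) hζo
  · filter_upwards [h4.filter_mono nhdsWithin_le_nhds, self_mem_nhdsWithin, hgood,
      h3.eventually hgood] with s h hne hs1 hs2
    have h5 : ζ (ι s) = ζ s := inv_injective (h hne).1
    refine ⟨h5, ?_⟩
    have h6 := (h hne).2
    simp only [hw_def, h5] at h6
    rw [← mul_neg, ← inv_neg] at h6
    exact inv_injective (mul_left_cancel₀ (pow_ne_zero m hs1.2.1) h6)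

end IsLocalChart

end ConformalPolygon

open Filter in
/-- A continuous square root agrees with a local branch. -/
theorem eventually_eq_of_sq_eq {X : Type*} {l : Filter X} {ζ η : X → ℂ} {D Y : ℂ → ℂ} {z y : ℂ}
    (hY : ContinuousAt Y z) (hYz : Y z = y) (hYs : ∀ᶠ w in 𝓝 z, Y w ^ 2 = D w) (hy : y ≠ 0)
    (hζ : Tendsto ζ l (𝓝 z)) (hη : Tendsto η l (𝓝 y)) (hc : ∀ᶠ x in l, η x ^ 2 = D (ζ x)) :
    ∀ᶠ x in l, η x = Y (ζ x) := by
  -- The opposite branch is excluded because the sum tends to `2 * y ≠ 0`.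
  have h1 : Tendsto (fun x => η x + Y (ζ x)) l (𝓝 (y + y)) :=
    hη.add ((hYz ▸ hY.tendsto).comp hζ)
  have h2 : y + y ≠ 0 := by rw [← two_mul]; exact mul_ne_zero two_ne_zero hy
  filter_upwards [h1.eventually_ne h2, hc, hζ.eventually hYs] with x h3 h4 h5
  have h6 : (η x + Y (ζ x)) * (η x - Y (ζ x)) = 0 := by linear_combination h4 - h5
  exact sub_eq_zero.mp ((mul_eq_zero.mp h6).resolve_left h3)

open Filter in
/-- The limits of `g` at `f s₀` can be computed along a nonconstant holomorphic map `f`. -/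
theorem AnalyticAt.tendsto_of_tendsto_comp {f g : ℂ → ℂ} {s₀ : ℂ} {l : Filter ℂ}
    (hf : AnalyticAt ℂ f s₀) (hne : ∀ᶠ s in 𝓝[≠] s₀, f s ≠ f s₀)
    (hg : Tendsto (fun s => g (f s)) (𝓝[≠] s₀) l) : Tendsto g (𝓝[≠] (f s₀)) l := by
  have hopen : 𝓝 (f s₀) ≤ map f (𝓝 s₀) :=
    hf.eventually_constant_or_nhds_le_map_nhds.resolve_left fun h =>
      ((h.filter_mono nhdsWithin_le_nhds).and hne).exists.elim fun s hs => hs.2 hs.1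
  intro V hV
  have h1 : {s | s ∈ ({s₀}ᶜ : Set ℂ) → g (f s) ∈ V} ∈ 𝓝 s₀ := eventually_nhdsWithin_iff.mp (hg hV)
  refine mem_map.mpr (mem_nhdsWithin_iff_eventually.mpr ?_)
  filter_upwards [hopen (image_mem_map h1)]
  rintro z ⟨s, hs, rfl⟩ hz
  exact hs fun h => hz (by rw [Set.mem_singleton_iff.mp h]; rfl)

/-! ### Orders of the forms in local charts. -/

namespace ConformalPolygon.IsLocalChart

variable {n : ℕ} {P : ConformalPolygon n} {U : Set ℂ} {σ : ℂ → P.Z} {s₀ : ℂ}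

open Orthodisk

theorem meromorphicAt_canonicalForm (hσ : P.IsLocalChart U σ) (hs : s₀ ∈ U) (X : Orthodisk P) :
    MeromorphicAt (fun s => X.canonicalForm (σ s)) s₀ :=
  ((MeromorphicAt.const X.scale s₀).mul (hσ.meromorphicAt_yc hs)).mul
    (MeromorphicAt.fun_prod fun _ _ =>
      ((hσ.meromorphicAt_zc hs).sub (MeromorphicAt.const _ s₀)).zpow _)

theorem meromorphicAt_heightForm (hσ : P.IsLocalChart U σ) (hs : s₀ ∈ U) (X₁ X₂ : Orthodisk P) :
    MeromorphicAt (fun s => heightForm X₁ X₂ (σ s)) s₀ :=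
  MeromorphicAt.fun_prod fun _ _ =>
    ((hσ.meromorphicAt_zc hs).sub (MeromorphicAt.const _ s₀)).zpow _

theorem order_pullback_heightForm (hσ : P.IsLocalChart U σ) (hs : s₀ ∈ U) (X₁ X₂ : Orthodisk P)
    {o : Fin n → ℤ} {d : ℤ}
    (ho : ∀ i, meromorphicOrderAt (fun s => P.zc (σ s) - P.t i) s₀ = o i)
    (hd : meromorphicOrderAt (deriv fun s => P.zc (σ s)) s₀ = d) :
    meromorphicOrderAt (P.pullback (heightForm X₁ X₂) σ) s₀ =
      ((∑ i, (X₁.a i + X₂.a i) / 4 * o i + d : ℤ) : WithTop ℤ) := by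
  have hz := fun i => (hσ.meromorphicAt_zc hs).sub (MeromorphicAt.const (P.t i : ℂ) s₀)
  have h1 := meromorphicOrderAt_prod_zpow hz ho (fun i => (X₁.a i + X₂.a i) / 4)
  have h2 := meromorphicOrderAt_mul (hσ.meromorphicAt_heightForm hs X₁ X₂)
    (hσ.meromorphicAt_zc hs).deriv
  rw [hd, show meromorphicOrderAt (fun s => heightForm X₁ X₂ (σ s)) s₀ = _ from h1] at h2
  exact h2

theorem order_pullback_canonicalForm (hσ : P.IsLocalChart U σ) (hs : s₀ ∈ U) (X : Orthodisk P)
    {o : Fin n → ℤ} {k d : ℤ} (hk : meromorphicOrderAt (fun s => P.yc (σ s)) s₀ = k)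
    (ho : ∀ i, meromorphicOrderAt (fun s => P.zc (σ s) - P.t i) s₀ = o i)
    (hd : meromorphicOrderAt (deriv fun s => P.zc (σ s)) s₀ = d) :
    meromorphicOrderAt (P.pullback X.canonicalForm σ) s₀ =
      ((k + ∑ i, (X.a i - 1) / 2 * o i + d : ℤ) : WithTop ℤ) := by
  have hz := fun i => (hσ.meromorphicAt_zc hs).sub (MeromorphicAt.const (P.t i : ℂ) s₀)
  have h1 := meromorphicOrderAt_prod_zpow hz ho (fun i => (X.a i - 1) / 2)
  have h3 := (analyticAt_const (𝕜 := ℂ) (x := s₀)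
    (v := X.scale)).meromorphicOrderAt_of_ne_zero X.scale_ne
  have h4 := meromorphicOrderAt_mul (MeromorphicAt.const X.scale s₀) (hσ.meromorphicAt_yc hs)
  have h5 := meromorphicOrderAt_mul
    ((MeromorphicAt.const X.scale s₀).mul (hσ.meromorphicAt_yc hs))
    (MeromorphicAt.fun_prod (s := Finset.univ) fun i _ => (hz i).zpow ((X.a i - 1) / 2))
  have h2 := meromorphicOrderAt_mul (hσ.meromorphicAt_canonicalForm hs X)
    (hσ.meromorphicAt_zc hs).deriv
  replace h5 : meromorphicOrderAt (fun s => X.canonicalForm (σ s)) s₀ =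
    _ + ((∑ i, (X.a i - 1) / 2 * o i : ℤ) : WithTop ℤ) := h5.trans (congrArg₂ (· + ·) rfl h1)
  rw [hd, h5, h4, h3, zero_add, hk] at h2
  exact h2

theorem eventually_ordinary_punctured (hσ : P.IsLocalChart U σ) (hs : s₀ ∈ U) (hn : Odd n) :
    ∀ᶠ s in 𝓝[≠] s₀, s ∈ U ∧ σ s ∈ P.ordinary := by
  have hne : meromorphicOrderAt (fun s => P.yc (σ s)) s₀ ≠ ⊤ := by
    by_cases hinf : σ s₀ = OnePoint.infty
    · rw [(hσ.orders_infinity hs hinf hn).1]; exact WithTop.coe_ne_top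
    by_cases hy : P.yc (σ s₀) = 0
    · obtain ⟨i, hi⟩ := exists_vertex_of_yc_eq_zero hinf hy
      rw [(hσ.orders_finite_vertex hs hinf hi).1]; exact WithTop.coe_ne_top
    · rw [(hσ.orders_ordinary hs ⟨hinf, hy⟩).1]; exact WithTop.coe_ne_top
  filter_upwards [hσ.eventually_finite hs,
    (meromorphicOrderAt_ne_top_iff_eventually_ne_zero (hσ.meromorphicAt_yc hs)).mp hne] with s h1 h2
  exact ⟨h1.1, h1.2, h2⟩

end ConformalPolygon.IsLocalChart

namespace Orthodisk

open ConformalPolygon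

variable {n : ℕ} {P : ConformalPolygon n} {U : Set ℂ} {σ : ℂ → P.Z} {s₀ : ℂ}

theorem odd_card (X : Orthodisk P) : Odd n := by
  choose k hk using X.odd_a
  have h := X.odd_infty
  have h1 : ∑ i, X.a i = 2 * ∑ i, k i + n := by
    rw [Finset.sum_congr rfl fun i _ => hk i, Finset.sum_add_distrib, ← Finset.mul_sum]
    simp
  rw [h1] at h
  obtain ⟨m, hm⟩ := h
  rw [Nat.odd_iff]
  omega

theorem four_dvd (X₁ X₂ : Orthodisk P) (hmod : ∀ i, X₁.a i + X₂.a i ≡ 0 [ZMOD 4]) (i : Fin n) :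
    (X₁.a i + X₂.a i) / 4 * 4 = X₁.a i + X₂.a i :=
  Int.ediv_mul_cancel (Int.dvd_of_emod_eq_zero (hmod i))

/-- The orders of the forms on the part of `Z` on which the surface is defined. -/
theorem orders_of_mem_surfaceDomain (X₁ X₂ : Orthodisk P)
    (hmod : ∀ i, X₁.a i + X₂.a i ≡ 0 [ZMOD 4]) (hσ : P.IsLocalChart U σ) (hs : s₀ ∈ U)
    (hD : σ s₀ ∈ surfaceDomain X₁ X₂) :
    0 ≤ meromorphicOrderAt (P.pullback X₁.canonicalForm σ) s₀ ∧
    0 ≤ meromorphicOrderAt (P.pullback X₂.canonicalForm σ) s₀ ∧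
    0 ≤ meromorphicOrderAt (P.pullback (heightForm X₁ X₂) σ) s₀ ∧
    (σ s₀ ∉ branchPoints X₁ X₂ → meromorphicOrderAt (P.pullback X₁.canonicalForm σ) s₀ = 0 ∨
      meromorphicOrderAt (P.pullback X₂.canonicalForm σ) s₀ = 0) := by
  have h4 := four_dvd X₁ X₂ hmod
  by_cases hinf : σ s₀ = OnePoint.infty
  · obtain ⟨ho1, ho2, ho3, -⟩ := hσ.orders_infinity hs hinf X₁.odd_card
    obtain ⟨hD1, hD2⟩ := hD.1 hinf
    -- The sum of the orders is `-n + ∑ (1 - a i) - 3 = aInfty + 1`. The order of the height form is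
    -- the mean of the two canonical orders.
    have key : ∀ X : Orthodisk P,
        meromorphicOrderAt (P.pullback X.canonicalForm σ) s₀ = ((X.aInfty + 1 : ℤ) : WithTop ℤ) := by
      intro X
      rw [hσ.order_pullback_canonicalForm hs X ho1 ho2 ho3]
      congr 1
      have h : ∀ i, (X.a i - 1) / 2 * (-2) = 1 - X.a i := fun i => by
        obtain ⟨k, hk⟩ := X.odd_a i; omega
      rw [Finset.sum_congr rfl fun i _ => h i, Finset.sum_sub_distrib, aInfty]
      simp
      ring
    rw [key, key, hσ.order_pullback_heightForm hs X₁ X₂ ho2 ho3]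
    have o1 : Odd X₁.aInfty := X₁.odd_infty
    have o2 : Odd X₂.aInfty := X₂.odd_infty
    obtain ⟨k1, hk1⟩ := o1
    obtain ⟨k2, hk2⟩ := o2
    refine ⟨by exact_mod_cast (by omega), by exact_mod_cast (by omega), ?_, fun hB => ?_⟩
    · have hsum : (∑ i, (X₁.a i + X₂.a i) / 4) * 4 = ∑ i, X₁.a i + ∑ i, X₂.a i := by
        rw [Finset.sum_mul, Finset.sum_congr rfl fun i _ => h4 i, Finset.sum_add_distrib]
      rw [← Finset.sum_mul]
      simp only [aInfty] at hD1 hD2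
      exact_mod_cast (by omega)
    · have : ¬(0 < X₁.aInfty ∧ 0 < X₂.aInfty) := fun h => hB (Or.inl ⟨hinf, h⟩)
      rcases not_and_or.mp this with h | h
      · left; exact_mod_cast (by omega)
      · right; exact_mod_cast (by omega)
  by_cases hy : P.yc (σ s₀) = 0
  · obtain ⟨i, hi⟩ := exists_vertex_of_yc_eq_zero hinf hy
    obtain ⟨ho1, ho2, ho3, -⟩ := hσ.orders_finite_vertex hs hinf hi
    have ho2' : ∀ j, meromorphicOrderAt (fun s => P.zc (σ s) - P.t j) s₀ =
        ((if j = i then 2 else 0 : ℤ) : WithTop ℤ) := by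
      intro j; rw [ho2]; split_ifs <;> rfl
    obtain ⟨hD1, hD2⟩ := hD.2 hinf i hi
    -- Here `1 + (a i - 1) + 1 = a i + 1`. An odd datum above `-2` is at least `-1`, and if it is
    -- not positive it equals `-1`, so that the order is `0`.
    have key : ∀ X : Orthodisk P,
        meromorphicOrderAt (P.pullback X.canonicalForm σ) s₀ = ((X.a i + 1 : ℤ) : WithTop ℤ) := by
      intro X
      rw [hσ.order_pullback_canonicalForm hs X (k := 1) (d := 1) ho1 ho2' ho3]
      congr 1
      obtain ⟨k, hk⟩ := X.odd_a i
      simp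
      omega
    rw [key, key, hσ.order_pullback_heightForm hs X₁ X₂ (d := 1) ho2' ho3]
    obtain ⟨k1, hk1⟩ := X₁.odd_a i
    obtain ⟨k2, hk2⟩ := X₂.odd_a i
    refine ⟨by exact_mod_cast (by omega), by exact_mod_cast (by omega), ?_, fun hB => ?_⟩
    · simp only [mul_ite, mul_zero, Finset.sum_ite_eq', Finset.mem_univ, if_true]
      have := h4 i
      exact_mod_cast (by omega)
    · have : ¬(0 < X₁.a i ∧ 0 < X₂.a i) := fun h => hB (Or.inr ⟨hinf, i, hi, h⟩)
      rcases not_and_or.mp this with h | h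
      · left; exact_mod_cast (by omega)
      · right; exact_mod_cast (by omega)
  · obtain ⟨ho1, ho2, ho3⟩ := hσ.orders_ordinary hs ⟨hinf, hy⟩
    have key : ∀ X : Orthodisk P,
        meromorphicOrderAt (P.pullback X.canonicalForm σ) s₀ = 0 := by
      intro X
      rw [hσ.order_pullback_canonicalForm hs X (k := 0) (d := 0) (o := 0) ho1 ho2 ho3]
      simp
    rw [key, key, hσ.order_pullback_heightForm hs X₁ X₂ (d := 0) (o := 0) ho2 ho3]
    simp

end Orthodisk

/-! ### Potentials on the surface. -/

namespace ConformalPolygon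

variable {n : ℕ} {P : ConformalPolygon n}

/-- The function `F` on `Z` is a potential, at the ordinary points, of the form
`R₁ dz - conj (R₂ dz)`. -/
def IsPotential (P : ConformalPolygon n) (R₁ R₂ F : P.Z → ℂ) : Prop :=
  ∀ p ∈ P.ordinary, ∃ Y g : ℂ → ℂ, ContinuousAt Y (P.zc p) ∧ Y (P.zc p) = P.yc p ∧
    (∀ᶠ w in 𝓝 (P.zc p), Y w ^ 2 = ∏ i, (w - (P.t i : ℂ))) ∧
    HasFDerivAt g (pairForm (R₁ p) (R₂ p)) (P.zc p) ∧
    ∀ q ∈ P.ordinary, P.yc q = Y (P.zc q) → F q = g (P.zc q)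

open Filter in
-- A continuous approach to `p` stays on the branch `Y`, so the potential there is a function of `z`
-- alone. A general filter covers charts as well as curves, including one-sided limits at their end
-- points.
theorem IsPotential.exists_local {R₁ R₂ F : P.Z → ℂ} (hF : P.IsPotential R₁ R₂ F) {p : P.Z}
    (hp : p ∈ P.ordinary) : ∃ g : ℂ → ℂ, HasFDerivAt g (pairForm (R₁ p) (R₂ p)) (P.zc p) ∧
      ∀ {X : Type} (l : Filter X) (γ : X → P.Z), Tendsto (fun x => P.zc (γ x)) l (𝓝 (P.zc p)) →
        Tendsto (fun x => P.yc (γ x)) l (𝓝 (P.yc p)) → (∀ᶠ x in l, γ x ∈ P.ordinary) →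
        ∀ᶠ x in l, F (γ x) = g (P.zc (γ x)) := by
  obtain ⟨Y, g, hY, hYp, hYs, hg, hgF⟩ := hF p hp
  refine ⟨g, hg, fun l γ hz hy hord => ?_⟩
  have h := eventually_eq_of_sq_eq hY hYp hYs hp.2 hz hy (hord.mono fun x hx => yc_sq hx.1)
  filter_upwards [h, hord] with x h1 h2 using hgF _ h2 h1

theorem IsPotential.hasFDerivAt_chart {R₁ R₂ F : P.Z → ℂ} (hF : P.IsPotential R₁ R₂ F)
    {U : Set ℂ} {σ : ℂ → P.Z} (hσ : P.IsLocalChart U σ) {s : ℂ} (hs : s ∈ U)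
    (hord : σ s ∈ P.ordinary) :
    HasFDerivAt (fun s => F (σ s)) (pairForm (P.pullback R₁ σ s) (P.pullback R₂ σ s)) s := by
  obtain ⟨g, hg, hgF⟩ := hF.exists_local hord
  have hz := hσ.analyticAt_zc hs hord.1
  have hev := hgF (𝓝 s) σ hz.continuousAt (hσ.analyticAt_yc hs hord.1).continuousAt
    ((hσ.eventually_ordinary hs hord).mono fun _ h => h.2)
  have h1 := hg.comp s (hz.differentiableAt.hasDerivAt.hasFDerivAt.restrictScalars ℝ)
  refine (h1.congr_of_eventuallyEq hev).congr_fderiv ?_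
  ext v
  simp [pullback]
  ring

/-- The periods of the two forms of a potential are conjugate. -/
theorem IsPotential.formIntegral_eq_conj {R₁ R₂ F : P.Z → ℂ} (hF : P.IsPotential R₁ R₂ F)
    {γ : ℝ → P.Z} (hγ : P.IsClosedCurve γ)
    (hR₁ : ContinuousOn (fun τ => R₁ (γ τ)) (Set.Icc 0 1))
    (hR₂ : ContinuousOn (fun τ => R₂ (γ τ)) (Set.Icc 0 1)) :
    P.formIntegral R₁ γ = conj (P.formIntegral R₂ γ) := by
  obtain ⟨hord, hclosed, hz, hy⟩ := hγ
  set ζ : ℝ → ℂ := fun τ => P.zc (γ τ) with hζ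
  -- The one-sided derivative is continuous up to the end points. It replaces `deriv`, with which it
  -- agrees on the open interval, without changing the integral.
  set D : ℝ → ℂ := derivWithin ζ (Set.Icc 0 1) with hD
  have hDc : ContinuousOn D (Set.Icc 0 1) :=
    hz.continuousOn_derivWithin (uniqueDiffOn_Icc zero_lt_one) le_rfl
  have hDd : ∀ τ ∈ Set.Ioo (0 : ℝ) 1, deriv ζ τ = D τ := fun τ hτ =>
    (derivWithin_of_mem_nhds (Icc_mem_nhds hτ.1 hτ.2)).symm
  have hint : ∀ R : P.Z → ℂ, P.formIntegral R γ = ∫ τ in (0 : ℝ)..1, R (γ τ) * D τ := by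
    intro R
    rw [formIntegral, intervalIntegral.integral_of_le zero_le_one,
      intervalIntegral.integral_of_le zero_le_one, MeasureTheory.integral_Ioc_eq_integral_Ioo,
      MeasureTheory.integral_Ioc_eq_integral_Ioo]
    refine MeasureTheory.setIntegral_congr_fun measurableSet_Ioo fun τ hτ => ?_
    simp only [← hDd τ hτ, hζ]
  have hcont : ContinuousOn (fun τ => F (γ τ)) (Set.Icc 0 1) := by
    intro τ hτ
    obtain ⟨g, hg, hgF⟩ := hF.exists_local (hord τ hτ)
    have hzt := (hz.continuousOn τ hτ)
    have hev := hgF (𝓝[Set.Icc 0 1] τ) γ hzt (hy.continuousOn τ hτ)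
      (Filter.eventually_of_mem self_mem_nhdsWithin hord)
    have h1 : ContinuousWithinAt (fun τ => g (ζ τ)) (Set.Icc 0 1) τ :=
      ContinuousAt.comp_continuousWithinAt (g := g) (f := ζ) hg.continuousAt hzt
    exact h1.congr_of_eventuallyEq hev (hev.self_of_nhdsWithin hτ)
  have hderiv : ∀ τ ∈ Set.Ioo (0 : ℝ) 1, HasDerivAt (fun τ => F (γ τ))
      (R₁ (γ τ) * D τ - conj (R₂ (γ τ) * D τ)) τ := by
    intro τ hτ
    have hτ' := Set.Ioo_subset_Icc_self hτ
    have hnhds := Icc_mem_nhds hτ.1 hτ.2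
    obtain ⟨g, hg, hgF⟩ := hF.exists_local (hord τ hτ')
    have hzt := ((hz τ hτ').contDiffAt hnhds).differentiableAt one_ne_zero
    have hev := hgF (𝓝 τ) γ hzt.continuousAt ((hy.continuousOn τ hτ').continuousAt hnhds)
      (Filter.eventually_of_mem hnhds hord)
    have h1 := hg.comp_hasDerivAt τ hzt.hasDerivAt
    have h2 := h1.congr_of_eventuallyEq hev
    rw [pairForm_apply] at h2
    rw [← hDd τ hτ]
    exact h2
  have hc₁ : ContinuousOn (fun τ => R₁ (γ τ) * D τ) (Set.Icc 0 1) := hR₁.mul hDc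
  have hc₂ : ContinuousOn (fun τ => R₂ (γ τ) * D τ) (Set.Icc 0 1) := hR₂.mul hDc
  have huIcc : Set.uIcc (0 : ℝ) 1 = Set.Icc 0 1 := Set.uIcc_of_le zero_le_one
  have hi₁ : IntervalIntegrable (fun τ => R₁ (γ τ) * D τ) MeasureTheory.volume 0 1 :=
    ContinuousOn.intervalIntegrable (by rwa [huIcc])
  have hi₂ : IntervalIntegrable (fun τ => conj (R₂ (γ τ) * D τ)) MeasureTheory.volume 0 1 :=
    ContinuousOn.intervalIntegrable
      (by rw [huIcc]; exact Complex.continuous_conj.comp_continuousOn hc₂)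
  have hftc := intervalIntegral.integral_eq_sub_of_hasDerivAt_of_le zero_le_one hcont hderiv
    (hi₁.sub hi₂)
  rw [hclosed, sub_self, intervalIntegral.integral_sub hi₁ hi₂] at hftc
  rw [hint, hint, sub_eq_zero.mp hftc, intervalIntegral.integral_of_le zero_le_one,
    intervalIntegral.integral_of_le zero_le_one, integral_conj]

open Filter in
/-- Near a point at which the pull-backs of its forms extend holomorphically, a potential is
the difference of a holomorphic and an antiholomorphic function. -/
theorem IsPotential.exists_analytic {R₁ R₂ F : P.Z → ℂ} (hF : P.IsPotential R₁ R₂ F)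
    {U : Set ℂ} {σ : ℂ → P.Z} (hσ : P.IsLocalChart U σ) {s₀ : ℂ} (hs : s₀ ∈ U) (hn : Odd n)
    (hm₁ : MeromorphicAt (P.pullback R₁ σ) s₀) (hm₂ : MeromorphicAt (P.pullback R₂ σ) s₀)
    (ho₁ : 0 ≤ meromorphicOrderAt (P.pullback R₁ σ) s₀)
    (ho₂ : 0 ≤ meromorphicOrderAt (P.pullback R₂ σ) s₀)
    (hlim : ∀ L, Tendsto (fun s => F (σ s)) (𝓝[≠] s₀) (𝓝 L) → F (σ s₀) = L) :
    ∃ α₁ α₂ A₁ A₂ : ℂ → ℂ, AnalyticAt ℂ α₁ s₀ ∧ AnalyticAt ℂ α₂ s₀ ∧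
      P.pullback R₁ σ =ᶠ[𝓝[≠] s₀] α₁ ∧ P.pullback R₂ σ =ᶠ[𝓝[≠] s₀] α₂ ∧
      (∀ᶠ s in 𝓝 s₀, HasDerivAt A₁ (α₁ s) s ∧ HasDerivAt A₂ (α₂ s) s) ∧
      ∀ᶠ s in 𝓝 s₀, F (σ s) = A₁ s - conj (A₂ s) := by
  obtain ⟨α₁, hα₁, he₁⟩ := hm₁.meromorphicOrderAt_nonneg_iff.mp ho₁
  obtain ⟨α₂, hα₂, he₂⟩ := hm₂.meromorphicOrderAt_nonneg_iff.mp ho₂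
  obtain ⟨A₁, A₂, hA, hFA⟩ := exists_analytic_of_hasFDerivAt_pairForm
    (Ψ := fun s => F (σ s)) hα₁ hα₂ (by
      filter_upwards [hσ.eventually_ordinary_punctured hs hn, he₁, he₂] with s h1 h2 h3
      rw [← h2, ← h3]
      exact hF.hasFDerivAt_chart hσ h1.1 h1.2)
  refine ⟨α₁, α₂, A₁, A₂, hα₁, hα₂, he₁, he₂, hA, ?_⟩
  have hc : Tendsto (fun s => A₁ s - conj (A₂ s)) (𝓝 s₀) (𝓝 (A₁ s₀ - conj (A₂ s₀))) :=
    hA.self_of_nhds.1.continuousAt.tendsto.sub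
      ((Complex.continuous_conj.tendsto _).comp hA.self_of_nhds.2.continuousAt.tendsto)
  -- The potential has a limit along the puncture, and `hlim` says that its assigned value is this
  -- limit.
  have h0 := hlim _ ((hc.mono_left nhdsWithin_le_nhds).congr' (hFA.mono fun _ h => h.symm))
  rw [eventually_nhdsWithin_iff] at hFA
  filter_upwards [hFA] with s hs
  rcases eq_or_ne s s₀ with rfl | hne
  · exact h0
  · exact hs hne

end ConformalPolygon

/-! ### The Weierstrass representation in a chart. -/

/-- The real linear map that assembles the three coordinates of the surface from its two
potentials. -/
noncomputable def coordinateMap : ℂ × ℂ →L[ℝ] EuclideanSpace ℝ (Fin 3) :=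
  LinearMap.toContinuousLinearMap
    -- The first potential has real part `Re ∫ (G - G⁻¹) dh` and imaginary part `Im ∫ (G + G⁻¹) dh`,
    -- up to constants; the factor `I / 2` turns the latter into minus half of it. The second
    -- potential is `2 * Re ∫ dh`.
    { toFun := fun p => !₂[(1 / 2) * p.1.re, -((1 / 2) * p.1.im), (1 / 2) * p.2.re]
      map_add' := fun p q => by
        ext k; fin_cases k <;> simp <;> ring
      map_smul' := fun r p => by
        ext k; fin_cases k <;> simp <;> ring }

theorem coordinateMap_apply (p : ℂ × ℂ) :
    coordinateMap p = !₂[(1 / 2) * p.1.re, -((1 / 2) * p.1.im), (1 / 2) * p.2.re] := rfl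

/-- The local form of the Weierstrass representation. -/
theorem coordinateMap_conformal {α₁ α₂ β A₁ A₂ B₁ B₂ : ℂ → ℂ} {s₀ : ℂ}
    (hα : α₁ s₀ * α₂ s₀ = β s₀ ^ 2)
    (hA : ∀ᶠ s in 𝓝 s₀, HasDerivAt A₁ (α₁ s) s ∧ HasDerivAt A₂ (α₂ s) s)
    (hB : ∀ᶠ s in 𝓝 s₀, HasDerivAt B₁ (β s) s ∧ HasDerivAt B₂ (-β s) s)
    {Φ : ℂ → EuclideanSpace ℝ (Fin 3)}
    (hΦ : ∀ᶠ s in 𝓝 s₀, Φ s = coordinateMap (A₁ s - conj (A₂ s), B₁ s - conj (B₂ s))) :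
    InnerProductSpace.HarmonicAt Φ s₀ ∧
      ‖fderiv ℝ Φ s₀ 1‖ = ‖fderiv ℝ Φ s₀ Complex.I‖ ∧
      inner ℝ (fderiv ℝ Φ s₀ 1) (fderiv ℝ Φ s₀ Complex.I) = 0 ∧
      (α₁ s₀ ≠ 0 ∨ α₂ s₀ ≠ 0 → Function.Injective (fderiv ℝ Φ s₀)) := by
  have hana : ∀ {f g : ℂ → ℂ}, (∀ᶠ s in 𝓝 s₀, HasDerivAt f (g s) s) → AnalyticAt ℂ f s₀ :=
    fun h => Complex.analyticAt_iff_eventually_differentiableAt.mpr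
      (h.mono fun _ h => h.differentiableAt)
  have hA₁ := hana (hA.mono fun _ h => h.1)
  have hA₂ := hana (hA.mono fun _ h => h.2)
  have hB₁ := hana (hB.mono fun _ h => h.1)
  have hB₂ := hana (hB.mono fun _ h => h.2)
  have hharm : ∀ {f g : ℂ → ℂ}, AnalyticAt ℂ f s₀ → AnalyticAt ℂ g s₀ →
      InnerProductSpace.HarmonicAt (fun s => f s - conj (g s)) s₀ := fun hf hg =>
    hf.harmonicAt.sub (hg.harmonicAt.comp_CLM (Complex.conjCLE : ℂ →L[ℝ] ℂ))
  have hd : HasFDerivAt Φ (coordinateMap.comp ((pairForm (α₁ s₀) (α₂ s₀)).prod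
      (pairForm (β s₀) (-β s₀)))) s₀ := by
    have h1 := hA.self_of_nhds.1.hasFDerivAt_pairForm hA.self_of_nhds.2
    have h2 := hB.self_of_nhds.1.hasFDerivAt_pairForm hB.self_of_nhds.2
    exact (coordinateMap.hasFDerivAt.comp s₀ (h1.prodMk h2)).congr_of_eventuallyEq hΦ
  -- The real part of `α₁ α₂ = β ^ 2` says that the two partial derivatives have equal length, the
  -- imaginary part that they are orthogonal.
  have hre := congrArg Complex.re hα
  have him := congrArg Complex.im hα
  simp only [sq, Complex.mul_re, Complex.mul_im] at hre him
  rw [hd.fderiv]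
  refine ⟨?_, ?_, ?_, ?_⟩
  · have h1 := (hharm hA₁ hA₂).comp_CLM (coordinateMap.comp (ContinuousLinearMap.inl ℝ ℂ ℂ))
    have h2 := (hharm hB₁ hB₂).comp_CLM (coordinateMap.comp (ContinuousLinearMap.inr ℝ ℂ ℂ))
    refine (InnerProductSpace.harmonicAt_congr_nhds ?_).mpr (h1.add h2)
    filter_upwards [hΦ] with s hs
    rw [hs]
    simp only [Pi.add_apply, Function.comp_apply, ContinuousLinearMap.comp_apply, ← map_add]
    simp
  · rw [EuclideanSpace.norm_eq, EuclideanSpace.norm_eq]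
    congr 1
    simp only [ContinuousLinearMap.comp_apply, ContinuousLinearMap.prod_apply, coordinateMap_apply,
      Fin.sum_univ_three, Real.norm_eq_abs, sq_abs]
    simp
    nlinarith [hre]
  · simp only [ContinuousLinearMap.comp_apply, ContinuousLinearMap.prod_apply, coordinateMap_apply,
      PiLp.inner_apply, Fin.sum_univ_three]
    simp
    nlinarith [him]
  · intro hne
    rw [injective_iff_map_eq_zero]
    intro v hv
    simp only [ContinuousLinearMap.comp_apply, ContinuousLinearMap.prod_apply,
      coordinateMap_apply] at hv
    have e0 := congrArg (fun x : EuclideanSpace ℝ (Fin 3) => x 0) hv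
    have e1 := congrArg (fun x : EuclideanSpace ℝ (Fin 3) => x 1) hv
    have e2 := congrArg (fun x : EuclideanSpace ℝ (Fin 3) => x 2) hv
    have hprod : (α₁ s₀ * v) * (α₂ s₀ * v) = (β s₀ * v) ^ 2 := by
      rw [mul_pow, ← hα]; ring
    simp only [pairForm_apply] at e0 e1 e2
    generalize hw₁ : α₁ s₀ * v = w₁ at *
    generalize hw₂ : α₂ s₀ * v = w₂ at *
    have e2' : (β s₀ * v).re = 0 := by
      rw [neg_mul] at e2
      generalize β s₀ * v = w₃ at *
      simp at e2
      linarith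
    generalize β s₀ * v = w₃ at *
    simp at e0 e1
    have h3 := congrArg Complex.re hprod
    simp only [sq, Complex.mul_re, e2'] at h3
    -- For `v` in the kernel, `w₂ = conj w₁` and `w₃` is imaginary. So `‖w₁‖ ^ 2 = w₃ ^ 2 ≤ 0`, and
    -- `w₁`, `w₂` vanish.
    have e0' : w₂.re = w₁.re := by linarith
    have e1' : w₂.im = -w₁.im := by linarith
    rw [e0', e1'] at h3
    have hz : w₁ = 0 := by
      apply Complex.ext <;> simp <;> nlinarith [sq_nonneg w₁.re, sq_nonneg w₁.im, sq_nonneg w₃.im]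
    have hz2 : w₂ = 0 := by
      apply Complex.ext <;> simp [e0', e1', hz]
    rcases hne with h | h
    · exact (mul_eq_zero.mp (hw₁.trans hz)).resolve_left h
    · exact (mul_eq_zero.mp (hw₂.trans hz2)).resolve_left h

/-! ### Values of the potentials over the vertices. -/

namespace Orthodisk

open ConformalPolygon Filter

variable {n : ℕ} {P : ConformalPolygon n}

open Classical in
/-- The extension by `0` of an odd function on the ordinary points of `Z`. -/
noncomputable def oddExtension (P : ConformalPolygon n) (Ψ : ℂ → ℂ → ℂ) (p : P.Z) : ℂ :=
  if p ∈ P.ordinary then Ψ (P.zc p) (P.yc p) else 0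

open Classical in
/-- The lift to `Z` of a function on the sphere, extended by its limits at the vertices. -/
noncomputable def evenExtension (P : ConformalPolygon n) (ψ : ℂ → ℂ) (p : P.Z) : ℂ :=
  if p ∈ P.ordinary then ψ (P.zc p)
  else if p = OnePoint.infty then limUnder (𝓝[≠] 0) (fun v => ψ v⁻¹)
  else limUnder (𝓝[≠] (P.zc p)) ψ

variable {U : Set ℂ} {σ : ℂ → P.Z} {s₀ : ℂ}

/-- The local hyperelliptic involution changes the sign of the function, so a limit satisfies `L =
-L`. This is why `0` is the right value at every vertex. -/
theorem oddExtension_eq_of_tendsto {Ψ : ℂ → ℂ → ℂ} (hodd : ∀ z y, Ψ z (-y) = -Ψ z y)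
    (hn : Odd n) (hσ : P.IsLocalChart U σ) (hs : s₀ ∈ U) (hord : σ s₀ ∉ P.ordinary) {L : ℂ}
    (hL : Tendsto (fun s => oddExtension P Ψ (σ s)) (𝓝[≠] s₀) (𝓝 L)) :
    oddExtension P Ψ (σ s₀) = L := by
  rw [oddExtension, if_neg hord]
  obtain ⟨ι, hι, hev⟩ : ∃ ι : ℂ → ℂ, Tendsto ι (𝓝[≠] s₀) (𝓝[≠] s₀) ∧ ∀ᶠ s in 𝓝[≠] s₀,
      P.zc (σ (ι s)) = P.zc (σ s) ∧ P.yc (σ (ι s)) = -P.yc (σ s) := by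
    by_cases hinf : σ s₀ = OnePoint.infty
    · exact (hσ.orders_infinity hs hinf hn).2.2.2
    · have hy : P.yc (σ s₀) = 0 := by
        by_contra h; exact hord ⟨hinf, h⟩
      obtain ⟨i, hi⟩ := exists_vertex_of_yc_eq_zero hinf hy
      exact (hσ.orders_finite_vertex hs hinf hi).2.2.2
  have hO := hσ.eventually_ordinary_punctured hs hn
  have h1 : Tendsto (fun s => oddExtension P Ψ (σ s)) (𝓝[≠] s₀) (𝓝 (-L)) := by
    refine ((hL.comp hι).neg).congr' ?_
    filter_upwards [hev, hO, hι.eventually hO] with s h1 h2 h3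
    simp only [Function.comp_apply, oddExtension, if_pos h2.2, if_pos h3.2, h1.1, h1.2, hodd,
      neg_neg]
  exact (self_eq_neg.mp (tendsto_nhds_unique hL h1)).symm

/-- The chart coordinate `z`, or `z⁻¹` at infinity, is nonconstant and hence open. A limit in the
chart is therefore a limit of `ψ` in the plane, which is the value chosen through `limUnder`. -/
theorem evenExtension_eq_of_tendsto {ψ : ℂ → ℂ} (hn : Odd n) (hσ : P.IsLocalChart U σ)
    (hs : s₀ ∈ U) (hord : σ s₀ ∉ P.ordinary) {L : ℂ}
    (hL : Tendsto (fun s => evenExtension P ψ (σ s)) (𝓝[≠] s₀) (𝓝 L)) :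
    evenExtension P ψ (σ s₀) = L := by
  have hO := hσ.eventually_ordinary_punctured hs hn
  have h1 : Tendsto (fun s => ψ (P.zc (σ s))) (𝓝[≠] s₀) (𝓝 L) := by
    refine hL.congr' ?_
    filter_upwards [hO] with s h
    rw [evenExtension, if_pos h.2]
  rw [evenExtension, if_neg hord]
  split_ifs with hinf
  · have hv := hσ.analyticAt_inv_zc hs hinf
    have h0 : (P.zc (σ s₀))⁻¹ = 0 := by simp [hinf]
    have hne : ∀ᶠ s in 𝓝[≠] s₀, (P.zc (σ s))⁻¹ ≠ (P.zc (σ s₀))⁻¹ := by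
      filter_upwards [(hσ.tendsto_zc_cobounded hs hinf).eventually
        (Bornology.eventually_ne_cobounded 0)] with s h
      rw [h0]; exact inv_ne_zero h
    have h2 := hv.tendsto_of_tendsto_comp (g := fun v => ψ v⁻¹) hne (by simpa using h1)
    simp only [h0] at h2
    exact h2.limUnder_eq
  · have hy : P.yc (σ s₀) = 0 := by
      by_contra h; exact hord ⟨hinf, h⟩
    obtain ⟨i, hi⟩ := exists_vertex_of_yc_eq_zero hinf hy
    refine ((hσ.analyticAt_zc hs hinf).tendsto_of_tendsto_comp ?_ h1).limUnder_eq
    filter_upwards [hO] with s h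
    rw [hi]
    exact zc_ne_of_ordinary h.2 i

theorem continuousOn_canonicalForm {Y : Type*} [TopologicalSpace Y] (X : Orthodisk P) {γ : Y → P.Z}
    {S : Set Y} (hord : ∀ τ ∈ S, γ τ ∈ P.ordinary) (hz : ContinuousOn (fun τ => P.zc (γ τ)) S)
    (hy : ContinuousOn (fun τ => P.yc (γ τ)) S) :
    ContinuousOn (fun τ => X.canonicalForm (γ τ)) S := by
  unfold canonicalForm
  refine (continuousOn_const.mul hy).mul (continuousOn_finsetProd _ fun i _ => ?_)
  exact (hz.sub continuousOn_const).zpow₀ _ fun τ hτ =>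
    Or.inl (sub_ne_zero.mpr (zc_ne_of_ordinary (hord τ hτ) i))

theorem continuousOn_heightForm {Y : Type*} [TopologicalSpace Y] (X₁ X₂ : Orthodisk P)
    {γ : Y → P.Z} {S : Set Y} (hord : ∀ τ ∈ S, γ τ ∈ P.ordinary)
    (hz : ContinuousOn (fun τ => P.zc (γ τ)) S) :
    ContinuousOn (fun τ => heightForm X₁ X₂ (γ τ)) S := by
  unfold heightForm
  refine continuousOn_finsetProd _ fun i _ => ?_
  exact (hz.sub continuousOn_const).zpow₀ _ fun τ hτ =>
    Or.inl (sub_ne_zero.mpr (zc_ne_of_ordinary (hord τ hτ) i))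

theorem heightForm_ne_zero (X₁ X₂ : Orthodisk P) {p : P.Z} (hp : p ∈ P.ordinary) :
    heightForm X₁ X₂ p ≠ 0 :=
  Finset.prod_ne_zero_iff.mpr fun i _ =>
    zpow_ne_zero _ (sub_ne_zero.mpr (zc_ne_of_ordinary hp i))

theorem canonicalForm_eq (X : Orthodisk P) (p : P.Z) :
    X.canonicalForm p = X.scale * P.yc p * X.ratFactor (P.zc p) := rfl

theorem canonicalForm_ne_zero (X : Orthodisk P) {p : P.Z} (hp : p ∈ P.ordinary) :
    X.canonicalForm p ≠ 0 := by
  rw [canonicalForm_eq]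
  exact mul_ne_zero (mul_ne_zero X.scale_ne hp.2) (X.ratFactor_ne_zero (zc_ne_of_ordinary hp))

/-- The factor `y ^ 2` adds `1` to each exponent, and `1 + (a - 1) / 2 + (b - 1) / 2 = (a + b) / 2`
is twice `(a + b) / 4`. All these divisions are exact since the data are odd and `4` divides `a +
b`. -/
theorem canonicalForm_mul (X₁ X₂ : Orthodisk P) (hmod : ∀ i, X₁.a i + X₂.a i ≡ 0 [ZMOD 4])
    {p : P.Z} (hp : p ∈ P.ordinary) :
    X₁.canonicalForm p * X₂.canonicalForm p = X₁.scale * X₂.scale * heightForm X₁ X₂ p ^ 2 := by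
  have h1 : P.yc p ^ 2 * (X₁.ratFactor (P.zc p) * X₂.ratFactor (P.zc p)) =
      heightForm X₁ X₂ p ^ 2 := by
    rw [yc_sq hp.1, ratFactor, ratFactor, heightForm, ← Finset.prod_mul_distrib,
      ← Finset.prod_mul_distrib, ← Finset.prod_pow]
    refine Finset.prod_congr rfl fun i _ => ?_
    have hne := sub_ne_zero.mpr (zc_ne_of_ordinary hp i)
    have h4 := four_dvd X₁ X₂ hmod i
    obtain ⟨k1, hk1⟩ := X₁.odd_a i
    obtain ⟨k2, hk2⟩ := X₂.odd_a i
    rw [← zpow_natCast, ← zpow_mul, ← zpow_add₀ hne, ← zpow_one_add₀ hne]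
    congr 1
    push_cast
    omega
  rw [canonicalForm_eq, canonicalForm_eq, ← h1]
  ring

end Orthodisk

/-! ### Assembly of the minimal surface. -/

open ConformalPolygon Orthodisk in
theorem theorem3p3p5 {n : ℕ} (P : ConformalPolygon n) (X₁ X₂ : Orthodisk P)
    (hrefl : Orthodisk.Reflexive X₁ X₂)
    (hmod : ∀ i, X₁.a i + X₂.a i ≡ 0 [ZMOD 4]) :
    ∃ (c : ℂ) (r : ℝ) (G h : P.Z → ℂ),
      ‖c‖ = 1 ∧ r ≠ 0 ∧
      (∀ p, h p = r * Orthodisk.heightForm X₁ X₂ p) ∧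
      P.IsMeromorphic h ∧ P.IsMeromorphic G ∧
      (∀ p ∈ P.ordinary,
        G p * h p = c * X₁.canonicalForm p ∧ (G p)⁻¹ * h p = c * X₂.canonicalForm p) ∧
      (∀ γ : ℝ → P.Z, P.IsClosedCurve γ →
        (P.formIntegral h γ).re = 0 ∧
        P.formIntegral (fun p => G p * h p) γ
          = conj (P.formIntegral (fun p => (G p)⁻¹ * h p) γ)) ∧
      ∃ Φ : P.Z → EuclideanSpace ℝ (Fin 3),
        IsWeierstrassSurface P G h (Orthodisk.surfaceDomain X₁ X₂)
          (Orthodisk.branchPoints X₁ X₂) Φ := by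
  obtain ⟨e, he, hconj⟩ := hrefl.2
  have hn := X₁.odd_card
  set c : ℂ := conj e with hc_def
  have hc : ‖c‖ = 1 := by rw [hc_def, Complex.norm_conj, he]
  have hc0 : c ≠ 0 := norm_ne_zero_iff.mp (by rw [hc]; exact one_ne_zero)
  set r : ℝ := Real.sqrt (‖X₁.scale‖ * ‖X₂.scale‖) with hr_def
  have hpos : 0 < ‖X₁.scale‖ * ‖X₂.scale‖ :=
    mul_pos (norm_pos_iff.mpr X₁.scale_ne) (norm_pos_iff.mpr X₂.scale_ne)
  have hr : r ≠ 0 := (Real.sqrt_pos.mpr hpos).ne'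
  have hrc : (r : ℂ) ≠ 0 := by exact_mod_cast hr
  -- The rotated scale factors point in conjugate directions, so their product is the product of
  -- their absolute values.
  have hr2 : c ^ 2 * (X₁.scale * X₂.scale) = (r : ℂ) ^ 2 := by
    have h1 := conj_mul_scale_left e X₁
    have h2 := hconj.conj_mul_scale_right he
    have h3 := conj_mul_self_lastDirection he X₁
    rw [← hc_def] at h1 h2
    rw [hr_def, ← Complex.ofReal_pow, Real.sq_sqrt hpos.le]
    push_cast
    linear_combination c * X₂.scale * h1 + ‖X₁.scale‖ * lastDirection e X₁ * h2 +
      ‖X₁.scale‖ * ‖X₂.scale‖ * h3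
  set h : P.Z → ℂ := fun p => r * heightForm X₁ X₂ p with hh_def
  set R₁ : P.Z → ℂ := fun p => c * X₁.canonicalForm p with hR₁_def
  set R₂ : P.Z → ℂ := fun p => c * X₂.canonicalForm p with hR₂_def
  set G : P.Z → ℂ := fun p => R₁ p / h p with hG_def
  have hRR : ∀ p ∈ P.ordinary, R₁ p * R₂ p = h p ^ 2 := by
    intro p hp
    have := canonicalForm_mul X₁ X₂ hmod hp
    simp only [hR₁_def, hR₂_def, hh_def]
    linear_combination c ^ 2 * this + heightForm X₁ X₂ p ^ 2 * hr2
  have hGh : ∀ p ∈ P.ordinary, G p * h p = R₁ p ∧ (G p)⁻¹ * h p = R₂ p := by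
    intro p hp
    have h1 : h p ≠ 0 := mul_ne_zero hrc (heightForm_ne_zero X₁ X₂ hp)
    have h2 : R₁ p ≠ 0 := mul_ne_zero hc0 (X₁.canonicalForm_ne_zero hp)
    refine ⟨div_mul_cancel₀ _ h1, ?_⟩
    simp only [hG_def, inv_div]
    rw [div_mul_eq_mul_div, div_eq_iff h2, ← sq, ← hRR p hp, mul_comm]
  -- the potentials
  obtain ⟨Ψ, hodd, hΨ⟩ := hconj.exists_potential he
  obtain ⟨ψ, hψ⟩ := exists_height_potential P.strictMono.injective
    (by have := P.three_le; omega) (fun i => (X₁.a i + X₂.a i) / 4)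
  have hpot : P.IsPotential R₁ R₂ (oddExtension P Ψ) := by
    intro p hp
    obtain ⟨Y, hY, hYp, hYs, hYd⟩ := hΨ (P.zc p) (P.yc p) (yc_sq hp.1) hp.2
    refine ⟨Y, _, hY, hYp, hYs, hYd, fun q hq hqY => ?_⟩
    rw [oddExtension, if_pos hq, hqY]
  have hpoth : P.IsPotential h (fun p => -h p) (evenExtension P fun z => r * ψ z) := by
    intro p hp
    obtain ⟨Y, hY, hYp, hYs, -⟩ := hΨ (P.zc p) (P.yc p) (yc_sq hp.1) hp.2
    refine ⟨Y, fun z => r * ψ z, hY, hYp, hYs, ?_, fun q hq _ => by rw [evenExtension, if_pos hq]⟩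
    refine ((hψ _ (zc_ne_of_ordinary hp)).const_mul (r : ℂ)).congr_fderiv ?_
    ext v
    simp [hh_def, heightForm]
    ring
  -- meromorphy of the pull-backs
  have hmh : ∀ {U : Set ℂ} {σ : ℂ → P.Z} {s₀ : ℂ}, P.IsLocalChart U σ → s₀ ∈ U →
      MeromorphicAt (fun s => h (σ s)) s₀ := fun hσ hs =>
    (MeromorphicAt.const _ _).mul (hσ.meromorphicAt_heightForm hs X₁ X₂)
  have hmR : ∀ (X : Orthodisk P) {U : Set ℂ} {σ : ℂ → P.Z} {s₀ : ℂ}, P.IsLocalChart U σ →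
      s₀ ∈ U → MeromorphicAt (fun s => c * X.canonicalForm (σ s)) s₀ := fun X _ _ _ hσ hs =>
    (MeromorphicAt.const _ _).mul (hσ.meromorphicAt_canonicalForm hs X)
  refine ⟨c, r, G, h, hc, hr, fun p => rfl, fun U σ hσ s hs => hmh hσ hs,
    fun U σ hσ s hs => (hmR X₁ hσ hs).div (hmh hσ hs), hGh, fun γ hγ => ⟨?_, ?_⟩, ?_⟩
  · have hcont := continuousOn_heightForm X₁ X₂ hγ.1 hγ.2.2.1.continuousOn
    have hch : ContinuousOn (fun τ => h (γ τ)) (Set.Icc 0 1) := continuousOn_const.mul hcont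
    -- For the pair `(h, -h)` conjugate periods mean `∫ h = -conj (∫ h)`, so the period is
    -- imaginary.
    have h1 := hpoth.formIntegral_eq_conj hγ hch hch.neg
    have h2 : P.formIntegral (fun p => -h p) γ = -P.formIntegral h γ := by
      simp only [formIntegral, neg_mul, intervalIntegral.integral_neg]
    rw [h2] at h1
    have h3 := congrArg Complex.re h1
    simp at h3
    linarith
  · have hint : ∀ {R R' : P.Z → ℂ}, (∀ p ∈ P.ordinary, R p = R' p) →
        P.formIntegral R γ = P.formIntegral R' γ := by
      intro R R' hR
      refine intervalIntegral.integral_congr fun τ hτ => ?_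
      rw [Set.uIcc_of_le zero_le_one] at hτ
      simp only [hR _ (hγ.1 τ hτ)]
    rw [hint fun p hp => (hGh p hp).1, hint fun p hp => (hGh p hp).2]
    exact hpot.formIntegral_eq_conj hγ
      (continuousOn_const.mul (continuousOn_canonicalForm X₁ hγ.1 hγ.2.2.1.continuousOn
        hγ.2.2.2.continuousOn))
      (continuousOn_const.mul (continuousOn_canonicalForm X₂ hγ.1 hγ.2.2.1.continuousOn
        hγ.2.2.2.continuousOn))
  refine ⟨fun p => coordinateMap (oddExtension P Ψ p, evenExtension P (fun z => r * ψ z) p),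
    fun U σ hσ s hs => ⟨fun hord v k => ?_, fun hD => ?_⟩⟩
  · have h1 := hpot.hasFDerivAt_chart hσ hs hord
    have h2 := hpoth.hasFDerivAt_chart hσ hs hord
    have h3 := coordinateMap.hasFDerivAt.comp s (h1.prodMk h2)
    rw [show fderiv ℝ (fun w => coordinateMap (oddExtension P Ψ (σ w),
      evenExtension P (fun z => r * ψ z) (σ w))) s = _ from h3.fderiv]
    obtain ⟨hg1, hg2⟩ := hGh _ hord
    simp only [ContinuousLinearMap.comp_apply, ContinuousLinearMap.prod_apply, coordinateMap_apply,
      pairForm_apply, pullback, weierstrassForm]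
    fin_cases k
    · simp only [← hg1, ← hg2]
      simp
      ring
    · simp only [← hg1, ← hg2]
      simp
      ring
    · simp
      ring
  · obtain ⟨ho₁, ho₂, ho₃, hB⟩ := orders_of_mem_surfaceDomain X₁ X₂ hmod hσ hs hD
    have hconst : ∀ (b : ℂ) (R : P.Z → ℂ), b ≠ 0 →
        meromorphicOrderAt (P.pullback (fun p => b * R p) σ) s =
          meromorphicOrderAt (P.pullback R σ) s := by
      intro b R hb
      have := meromorphicOrderAt_mul_of_ne_zero (𝕜 := ℂ) (f := P.pullback R σ) (g := fun _ => b)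
        (x := s) analyticAt_const hb
      rw [← this]
      congr 1
      ext w
      simp [pullback, mul_assoc]
    have hneg : P.pullback (fun p => -h p) σ = -P.pullback h σ := by
      ext w; simp [pullback]
    have hmd := (hσ.meromorphicAt_zc hs).deriv
    have hmph : MeromorphicAt (P.pullback h σ) s := (hmh hσ hs).mul hmd
    -- The limit condition holds by continuity at ordinary points and by oddness at the vertices.
    obtain ⟨α₁, α₂, A₁, A₂, hα₁, hα₂, he₁, he₂, hA, hFA⟩ := hpot.exists_analytic hσ hs hn
      ((hmR X₁ hσ hs).mul hmd) ((hmR X₂ hσ hs).mul hmd)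
      ((hconst c X₁.canonicalForm hc0).symm ▸ ho₁) ((hconst c X₂.canonicalForm hc0).symm ▸ ho₂)
      (fun L hL => by
        by_cases hord : σ s ∈ P.ordinary
        · exact tendsto_nhds_unique ((hpot.hasFDerivAt_chart hσ hs hord).continuousAt.tendsto.mono_left
            nhdsWithin_le_nhds) hL
        · exact oddExtension_eq_of_tendsto hodd hn hσ hs hord hL)
    obtain ⟨β₁, β₂, B₁, B₂, hβ₁, hβ₂, hf₁, hf₂, hB', hFB⟩ := hpoth.exists_analytic hσ hs hn
      hmph (hneg ▸ hmph.neg)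
      ((hconst r (heightForm X₁ X₂) hrc).symm ▸ ho₃)
      (by rw [hneg, ← meromorphicOrderAt_neg]; exact (hconst r (heightForm X₁ X₂) hrc).symm ▸ ho₃)
      (fun L hL => by
        by_cases hord : σ s ∈ P.ordinary
        · exact tendsto_nhds_unique ((hpoth.hasFDerivAt_chart hσ hs hord).continuousAt.tendsto.mono_left
            nhdsWithin_le_nhds) hL
        · exact evenExtension_eq_of_tendsto hn hσ hs hord hL)
    have hβ : ∀ᶠ w in 𝓝 s, β₂ w = -β₁ w := by
      refine (ContinuousAt.eventuallyEq_nhds_iff_eventuallyEq_nhdsNE hβ₂.continuousAt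
        hβ₁.neg.continuousAt).mp ?_
      filter_upwards [hf₁, hf₂] with w h1 h2
      rw [← h2, hneg, Pi.neg_apply, Pi.neg_apply, h1]
    -- The identity `R₁ R₂ = h ^ 2` is available only at ordinary points. It extends to the center
    -- of the chart because the holomorphic representatives are continuous.
    have hprod : ∀ᶠ w in 𝓝 s, α₁ w * α₂ w = β₁ w ^ 2 := by
      refine (ContinuousAt.eventuallyEq_nhds_iff_eventuallyEq_nhdsNE
        (hα₁.continuousAt.mul hα₂.continuousAt) (hβ₁.continuousAt.pow 2)).mp ?_
      filter_upwards [he₁, he₂, hf₁, hσ.eventually_ordinary_punctured hs hn] with w h1 h2 h3 h4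
      simp only [Pi.mul_apply, Pi.pow_apply, ← h1, ← h2, ← h3, pullback]
      linear_combination (deriv (fun w => P.zc (σ w)) w) ^ 2 * hRR _ h4.2
    have hne : ∀ {α : ℂ → ℂ} {X : Orthodisk P}, AnalyticAt ℂ α s →
        P.pullback (fun p => c * X.canonicalForm p) σ =ᶠ[𝓝[≠] s] α →
        meromorphicOrderAt (P.pullback X.canonicalForm σ) s = 0 → α s ≠ 0 := by
      intro α X hα hev h0
      rw [← hconst c _ hc0, meromorphicOrderAt_congr hev, hα.meromorphicOrderAt_eq] at h0
      refine hα.analyticOrderAt_eq_zero.mp ?_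
      cases h1 : analyticOrderAt α s with
      | top => rw [h1] at h0; exact absurd h0 (by simp)
      | coe k =>
        rw [h1, ENat.map_natCast] at h0
        exact_mod_cast h0
    obtain ⟨g1, g2, g3, g4⟩ := coordinateMap_conformal (B₂ := B₂) hprod.self_of_nhds hA
      (by filter_upwards [hB', hβ] with w h1 h2; exact ⟨h1.1, h2 ▸ h1.2⟩)
      (Φ := fun w => coordinateMap (oddExtension P Ψ (σ w),
        evenExtension P (fun z => r * ψ z) (σ w)))
      (by filter_upwards [hFA, hFB] with w h1 h2; rw [h1, h2])
    exact ⟨g1, g2, g3, fun hnB => g4 ((hB hnB).imp (hne hα₁ he₁) (hne hα₂ he₂))⟩
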